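/- Let $d,m,n\in\mathbb N$ and let $\Delta\subset\mathbb R^d$ be a Jordan-measurable compact connected set with the origin in its interior; put $\Delta(r)=r\Delta$ for $r>0$. A measurable function $L:(0,\infty)\to(0,\infty)$ is slowly varying at infinity if $L(tr)/L(r)\to1$ as $r\to\infty$ for every $t>0$. Let $\gamma_{m+n}$ be the standard Gaussian measure on $\mathbb R^{m+n}$, let $H_k$ be the Hermite polynomials orthogonal with respect to the standard normal law, with leading coefficient $1$, and for a multi-index $v=(k_1,\dots,k_{m+n})$ of non-negative integers put $e_v(w)=\prod_jH_{k_j}(w_j)$ and $v!=\prod_jk_j!$. Let $N_l$ be the set of the $v$ with $\sum_jk_j=l$. Let $G\in L_2(\mathbb R^{m+n},\gamma_{m+n})$ with $\int G\,d\gamma_{m+n}=0$, let $C_v=\int Ge_v\,d\gamma_{m+n}$ be its Hermite coefficients, and let $\kappa\ge1$ be its Hermite rank, that is, the least $l\ge1$ such that $C_v\ne0$ for some $v\in N_l$. Let $0<\alpha<d/\kappa$ and $\beta>d$, let $L_1,L_2$ be slowly varying at infinity, and let $\eta(x)=(\eta_1(x),\dots,\eta_{m+n}(x))$, $x\in\mathbb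 R^d$, be a measurable zero-mean homogeneous isotropic Gaussian vector random field with independent components of unit variance such that, for $x\ne y$, $\mathbf{Cov}(\eta_j(x),\eta_j(y))=\|x-y\|^{-\beta}L_1(\|x-y\|)$ for $j\le m$ and $\mathbf{Cov}(\eta_j(x),\eta_j(y))=\|x-y\|^{-\alpha}L_2(\|x-y\|)$ for $m<j\le m+n$. Suppose that there is a $v\in N_\kappa$ with $C_v\neq0$ and $\sum_{j=m+1}^{m+n}k_j=\kappa$. Let $N_+=\{v\in N_l:\ l\ge\kappa,\ C_v\ne0\}$, let $\gamma$ be the minimum over $v\in N_+$ of $\beta\sum_{j\le m}k_j+\alpha\sum_{j>m}k_j$, and let $N_\kappa^*$ be the set of the $v\in N_+\cap N_\kappa$ at which this minimum is attained. Define $$K_r=\int_{\Delta(r)}G(\eta(x))\,dx,\qquad K_{r,\kappa}=\sum_{v\in N_\kappa}\frac{C_v}{v!}\int_{\Delta(r)}e_v(\eta(x))\,dx,\qquad K^*_{r,\kappa}=\sum_{v\in N^*_\kappa}\frac{C_v}{v!}\int_{\Delta(r)}e_v(\eta(x))\,dx .$$ Then for every $r>0$ the integrals converge absolutely with probability $1$,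 and the three random variables have finite and positive variances. If, as $r\to\infty$, a limit distribution exists for at least one of $K_r/\sqrt{\mathbf{Var}(K_r)}$ and $K_{r,\kappa}/\sqrt{\mathbf{Var}(K_{r,\kappa})}$, then the limit distribution of the other one exists as well, and the two coincide. Likewise, $K_{r,\kappa}/\sqrt{\mathbf{Var}(K_{r,\kappa})}$ and $K^*_{r,\kappa}/\sqrt{\mathbf{Var}(K^*_{r,\kappa})}$ have the same limit distribution, whenever it exists for one of them. Moreover, $$\mathbf{Var}(K_r)\sim\mathbf{Var}(K_{r,\kappa})\sim\mathbf{Var}(K^*_{r,\kappa}),\qquad r\to\infty .$$ -/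

import Mathlib

open MeasureTheory ProbabilityTheory Filter Topology
open scoped Pointwise Nat

noncomputable section

namespace StrongWeak

/-- A measurable function `L : (0,∞) → (0,∞)` that is slowly varying at infinity. Only the values of `L` on
`(0,∞)` matter. -/
structure SlowlyVarying (L : ℝ → ℝ) : Prop where
  measurable : Measurable (fun r : Set.Ioi (0 : ℝ) => L r)
  pos : ∀ r : ℝ, 0 < r → 0 < L r
  tendsto : ∀ t : ℝ, 0 < t → Tendsto (fun r : ℝ => L (t * r) / L r) atTop (𝓝 1)

/-- The observation window: a Jordan-measurable compact connected set with the origin in its interior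
(so that its Lebesgue measure is positive). -/
structure IsWindow {d : ℕ} (Δ : Set (EuclideanSpace ℝ (Fin d))) : Prop where
  isCompact : IsCompact Δ
  isConnected : IsConnected Δ
  jordan : volume (frontier Δ) = 0
  zero_mem : (0 : EuclideanSpace ℝ (Fin d)) ∈ interior Δ

/-- The covariance matrix `B(x)`: `B(0)` is the unit matrix and, for `x ≠ 0`, `B(x)` is diagonal with entries
`‖x‖^(-β) L₁(‖x‖)` (the first `m` components) and `‖x‖^(-α) L₂(‖x‖)` (the last `n` components). -/
def covMatrix {d : ℕ} (m n : ℕ) (α β : ℝ) (L₁ L₂ : ℝ → ℝ) (x : EuclideanSpace ℝ (Fin d)) :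
    Matrix (Fin m ⊕ Fin n) (Fin m ⊕ Fin n) ℝ :=
  open Classical in
  if x = 0 then 1
  else Matrix.diagonal
    (Sum.elim (fun _ => ‖x‖ ^ (-β) * L₁ ‖x‖) (fun _ => ‖x‖ ^ (-α) * L₂ ‖x‖))

/-- A measurable zero-mean homogeneous isotropic Gaussian vector random field on `ℝ^d` with independent components,
indexed by `Fin m ⊕ Fin n`, and covariance matrix `covMatrix`. -/
structure IsStrongWeakField {d m n : ℕ} {Ω : Type*} [MeasurableSpace Ω] (P : Measure Ω)
    (α β : ℝ) (L₁ L₂ : ℝ → ℝ)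
    (η : EuclideanSpace ℝ (Fin d) → Ω → (Fin m ⊕ Fin n → ℝ)) : Prop where
  measurable : Measurable (fun p : EuclideanSpace ℝ (Fin d) × Ω => η p.1 p.2)
  gaussian : IsGaussianProcess η P
  indep : iIndepFun (fun (j : Fin m ⊕ Fin n) (ω : Ω) (x : EuclideanSpace ℝ (Fin d)) => η x ω j) P
  mean_zero : ∀ x j, ∫ ω, η x ω j ∂P = 0
  cov_eq : ∀ x y i j,
    covariance (fun ω => η x ω i) (fun ω => η y ω j) P = covMatrix m n α β L₁ L₂ (x - y) i j

section Hermite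

variable {ι : Type*} [Fintype ι]

/-- The standard Gaussian measure on `ℝ^ι`, with density `∏ j, exp (-(w j)^2 / 2) / √(2π)`. -/
def stdGauss (ι : Type*) [Fintype ι] : Measure (ι → ℝ) :=
  Measure.pi fun _ => gaussianReal 0 1

/-- `e_v(w) = ∏ j, H_{v j}(w j)`, with the (probabilists') Hermite polynomials. -/
def hermiteProd (v : ι → ℕ) (w : ι → ℝ) : ℝ :=
  ∏ j, Polynomial.aeval (w j) (Polynomial.hermite (v j))

/-- The Hermite coefficient `C_v` of `G`. -/
def hermiteCoeff (G : (ι → ℝ) → ℝ) (v : ι → ℕ) : ℝ :=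
  ∫ w, G w * hermiteProd v w ∂(stdGauss ι)

/-- `v! = ∏ j, (v j)!`. -/
def multiFactorial (v : ι → ℕ) : ℕ := ∏ j, (v j)!

/-- `N_k`: the multi-indices of order `k`. -/
def multiIndices (ι : Type*) [Fintype ι] (k : ℕ) : Finset (ι → ℕ) :=
  open Classical in Finset.piAntidiag Finset.univ k

theorem mem_multiIndices {k : ℕ} {v : ι → ℕ} : v ∈ multiIndices ι k ↔ ∑ j, v j = k := by
  simp [multiIndices]

/-- `κ` is the Hermite rank of `G`: the least `k ≥ 1` such that some coefficient of order `k` does not vanish. -/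
def IsHermiteRank (G : (ι → ℝ) → ℝ) (κ : ℕ) : Prop :=
  IsLeast {k : ℕ | 1 ≤ k ∧ ∃ v ∈ multiIndices ι k, hermiteCoeff G v ≠ 0} κ

/-- `N₊`: the multi-indices of order at least `κ` whose coefficient does not vanish. -/
def Nplus (G : (ι → ℝ) → ℝ) (κ : ℕ) : Set (ι → ℕ) :=
  {v | hermiteCoeff G v ≠ 0 ∧ ∃ l, κ ≤ l ∧ v ∈ multiIndices ι l}

end Hermite

section Functionals

variable {d m n : ℕ} {Ω : Type*}

/-- The decay exponent `β ∑_{j ≤ m} k_j + α ∑_{j > m} k_j` of a multi-index. -/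
def weight (α β : ℝ) (v : Fin m ⊕ Fin n → ℕ) : ℝ :=
  β * ∑ j : Fin m, (v (Sum.inl j) : ℝ) + α * ∑ j : Fin n, (v (Sum.inr j) : ℝ)

/-- `γ`: the minimal decay exponent over `N₊`. -/
def minWeight (G : (Fin m ⊕ Fin n → ℝ) → ℝ) (κ : ℕ) (α β : ℝ) : ℝ :=
  sInf (weight α β '' Nplus G κ)

/-- `N*_l`: the elements of `N₊` of order `l` that have the minimal decay exponent. -/
def Nstar (G : (Fin m ⊕ Fin n → ℝ) → ℝ) (κ : ℕ) (α β : ℝ) (l : ℕ) : Finset (Fin m ⊕ Fin n → ℕ) :=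
  open Classical in
  (multiIndices (Fin m ⊕ Fin n) l).filter
    (fun v => v ∈ Nplus G κ ∧ weight α β v = minWeight G κ α β)

/-- `K_r = ∫_{Δ(r)} G(η(x)) dx`, where `Δ(r) = r • Δ`. -/
def K (Δ : Set (EuclideanSpace ℝ (Fin d))) (G : (Fin m ⊕ Fin n → ℝ) → ℝ)
    (η : EuclideanSpace ℝ (Fin d) → Ω → (Fin m ⊕ Fin n → ℝ)) (r : ℝ) (ω : Ω) : ℝ :=
  ∫ x in r • Δ, G (η x ω)

/-- The Hermite component `∑_{v ∈ S} (C_v / v!) ∫_{Δ(r)} e_v(η(x)) dx` over a finite set `S` of multi-indices. -/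
def hermiteSum (Δ : Set (EuclideanSpace ℝ (Fin d))) (G : (Fin m ⊕ Fin n → ℝ) → ℝ)
    (η : EuclideanSpace ℝ (Fin d) → Ω → (Fin m ⊕ Fin n → ℝ))
    (S : Finset (Fin m ⊕ Fin n → ℕ)) (r : ℝ) (ω : Ω) : ℝ :=
  ∑ v ∈ S, hermiteCoeff G v / (multiFactorial v : ℝ) * ∫ x in r • Δ, hermiteProd v (η x ω)

/-- `K_{r,l}`: the sum over all multi-indices of order `l`. -/
def Krank (Δ : Set (EuclideanSpace ℝ (Fin d))) (G : (Fin m ⊕ Fin n → ℝ) → ℝ)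
    (η : EuclideanSpace ℝ (Fin d) → Ω → (Fin m ⊕ Fin n → ℝ)) (l : ℕ) (r : ℝ) (ω : Ω) : ℝ :=
  hermiteSum Δ G η (multiIndices (Fin m ⊕ Fin n) l) r ω

/-- `K*_{r,l}`: the sum over `N*_l`. -/
def Kstar (Δ : Set (EuclideanSpace ℝ (Fin d))) (G : (Fin m ⊕ Fin n → ℝ) → ℝ)
    (η : EuclideanSpace ℝ (Fin d) → Ω → (Fin m ⊕ Fin n → ℝ))
    (κ : ℕ) (α β : ℝ) (l : ℕ) (r : ℝ) (ω : Ω) : ℝ :=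
  hermiteSum Δ G η (Nstar G κ α β l) r ω

/-- The normalized family `X_r / √Var(X_r)` converges in distribution to `ν` as `r → ∞`. -/
def HasLimitLaw [MeasurableSpace Ω] (P : Measure Ω) [IsProbabilityMeasure P] (X : ℝ → Ω → ℝ)
    (ν : Measure ℝ) [IsProbabilityMeasure ν] : Prop :=
  TendstoInDistribution (fun (r : ℝ) (ω : Ω) => X r ω / √(variance (X r) P)) atTop
    (id : ℝ → ℝ) (fun _ => P) ν

end Functionals

end StrongWeak

end

open StrongWeak

/-! By the Hermite expansion, and because Hermite polynomials of different degrees in two jointly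
Gaussian variables are orthogonal, the variance of `∫ F(η)` over the window is the sum over `v` of
`C_v² / v!` times the energy of `v`: the double integral of the product of the covariances with
multiplicities `v`. If `v` has order `κ` and charges only strongly dependent components, then its
covariance product is nonnegative far away and decays like `|x - y|^(-ακ)`, up to slow variation.
Since `ακ < d`, its energy is at least of order `r^(2d - s)` for every `s` strictly between `ακ`
and `d`. The covariance products of all other indices of order at least `κ` are dominated by one
common majorant which is negligible against the leading one at infinity, so that their total energy
is negligible too. Hence `K_r`, `K_{r,κ}` and `K*_{r,κ}` differ in `L²` by a negligible fraction of
their standard deviation, which transfers both variance asymptotics and normalized limit laws. -/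

namespace StrongWeak

open Asymptotics NormedSpace

section SlowVariation

theorem min_one_abs_sub_le (a b c : ℝ) :
    min 1 |a - c| ≤ min 1 |a - b| + min 1 |b - c| := by
  have htri := abs_sub_le a b c
  have hab := abs_nonneg (a - b)
  have hbc := abs_nonneg (b - c)
  simp only [min_def]
  split_ifs <;> linarith

theorem intervalIntegrable_min_one_abs_sub {f : ℝ → ℝ} (hf : Measurable f) (a b c y : ℝ) :
    IntervalIntegrable (fun s => min 1 |f (c + s) - y|) volume a b := by
  have hmeas : Measurable fun s => min 1 |f (c + s) - y| :=
    measurable_const.min ((hf.comp (measurable_const_add c)).sub_const y).norm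
  refine (intervalIntegrable_const (c := (1 : ℝ))).mono_fun' hmeas.aestronglyMeasurable
    (Eventually.of_forall fun s => ?_)
  change ‖min 1 |f (c + s) - y|‖ ≤ 1
  rw [Real.norm_of_nonneg (le_min zero_le_one (abs_nonneg _))]
  exact min_le_left _ _

theorem tendsto_integral_min_one_abs_sub {f : ℝ → ℝ} (hf : Measurable f)
    (hslow : ∀ u, Tendsto (fun x => f (x + u) - f x) atTop (𝓝 0)) (a b : ℝ) :
    Tendsto (fun x => ∫ s in a..b, min 1 |f (x + s) - f x|) atTop (𝓝 0) := by
  have hdom := intervalIntegral.tendsto_integral_filter_of_dominated_convergence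
    (μ := volume) (a := a) (b := b) (l := atTop) (F := fun x s => min 1 |f (x + s) - f x|)
    (f := fun _ => 0) (fun _ => (1 : ℝ))
    (Eventually.of_forall fun x =>
      (intervalIntegrable_min_one_abs_sub hf a b x (f x)).aestronglyMeasurable_restrict_uIoc)
    (Eventually.of_forall fun x => Eventually.of_forall fun s _ => by
      rw [Real.norm_of_nonneg (le_min zero_le_one (abs_nonneg _))]
      exact min_le_left _ _)
    intervalIntegrable_const
    (Eventually.of_forall fun s _ => by
      simpa using (tendsto_const_nhds (x := (1 : ℝ))).min (hslow s).abs)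
  simpa only [intervalIntegral.integral_zero] using hdom

theorem min_one_abs_sub_le_integral_add_integral {f : ℝ → ℝ} (hf : Measurable f) (x : ℝ) {u : ℝ}
    (hu : u ∈ Set.Icc (0 : ℝ) 1) :
    min 1 |f (x + u) - f x| ≤ (∫ s in (0 : ℝ)..2, min 1 |f (x + s) - f x|) +
      ∫ s in (0 : ℝ)..2, min 1 |f (x + u + s) - f (x + u)| := by
  have hint := intervalIntegrable_min_one_abs_sub hf
  have hnonneg (c y : ℝ) (a b : ℝ) :
      0 ≤ᵐ[volume.restrict (Set.Ioc a b)] fun s => min 1 |f (c + s) - y| :=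
    Eventually.of_forall fun s => le_min zero_le_one (abs_nonneg _)
  have hfirst : ∫ s in u..2, min 1 |f (x + s) - f x| ≤
      ∫ s in (0 : ℝ)..2, min 1 |f (x + s) - f x| :=
    intervalIntegral.integral_mono_interval hu.1 (by linarith [hu.2]) le_rfl
      (hnonneg x (f x) 0 2) (hint 0 2 x (f x))
  have hsecond : ∫ s in u..2, min 1 |f (x + s) - f (x + u)| ≤
      ∫ s in (0 : ℝ)..2, min 1 |f (x + u + s) - f (x + u)| := by
    have hshift := intervalIntegral.integral_comp_add_left (a := 0) (b := 2 - u)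
      (fun s => min 1 |f (x + s) - f (x + u)|) u
    simp only [add_zero, add_sub_cancel, ← add_assoc] at hshift
    rw [← hshift]
    exact intervalIntegral.integral_mono_interval le_rfl (by linarith [hu.2])
      (by linarith [hu.1]) (hnonneg (x + u) (f (x + u)) 0 2) (hint 0 2 (x + u) (f (x + u)))
  have hmean : (2 - u) * min 1 |f (x + u) - f x| ≤
      (∫ s in u..2, min 1 |f (x + s) - f x|) + ∫ s in u..2, min 1 |f (x + s) - f (x + u)| := by
    rw [← intervalIntegral.integral_add (hint u 2 x (f x)) (hint u 2 x (f (x + u))),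
      ← smul_eq_mul, ← intervalIntegral.integral_const]
    refine intervalIntegral.integral_mono_on (by linarith [hu.2]) intervalIntegrable_const
      ((hint u 2 x (f x)).add (hint u 2 x (f (x + u)))) fun s _ => ?_
    have htri := min_one_abs_sub_le (f (x + u)) (f (x + s)) (f x)
    rw [abs_sub_comm (f (x + u)) (f (x + s))] at htri
    linarith
  nlinarith [hu.2, le_min zero_le_one (abs_nonneg (f (x + u) - f x))]

-- The additive form of Karamata's uniform convergence theorem.
theorem eventually_forall_abs_sub_le_of_tendsto {f : ℝ → ℝ} (hf : Measurable f)
    (hslow : ∀ u, Tendsto (fun x => f (x + u) - f x) atTop (𝓝 0)) {ε : ℝ} (hε : 0 < ε) :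
    ∀ᶠ x in atTop, ∀ u ∈ Set.Icc (0 : ℝ) 1, |f (x + u) - f x| ≤ ε := by
  obtain ⟨X, hX⟩ := eventually_atTop.1 ((tendsto_integral_min_one_abs_sub hf hslow 0 2).eventually
    (gt_mem_nhds (show 0 < min ε (1 / 2) / 2 by positivity)))
  filter_upwards [eventually_ge_atTop X] with x hx u hu
  have hmin := min_one_abs_sub_le_integral_add_integral hf x hu
  have hleft := hX x hx
  have hright := hX (x + u) (by linarith [hu.1])
  rcases min_le_iff.1 (show min 1 |f (x + u) - f x| ≤ min ε (1 / 2) by linarith) with h | h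
  · linarith [min_le_right ε (1 / 2)]
  · exact h.trans (min_le_left _ _)

theorem abs_sub_le_of_forall_unit_step {f : ℝ → ℝ} {X ε : ℝ}
    (hstep : ∀ x, X ≤ x → ∀ u ∈ Set.Icc (0 : ℝ) 1, |f (x + u) - f x| ≤ ε) {x : ℝ} (hx : X ≤ x) :
    |f x - f X| ≤ ε * (x - X + 1) := by
  have hε : 0 ≤ ε := (abs_nonneg _).trans (hstep X le_rfl 0 (by simp))
  have hnat (k : ℕ) : |f (X + k) - f X| ≤ ε * k := by
    induction k with
    | zero => simp
    | succ k ih =>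
      have hlast := hstep (X + k) (by simp) 1 (by simp)
      rw [add_assoc] at hlast
      have htri := abs_sub_le (f (X + (k + 1))) (f (X + k)) (f X)
      push_cast
      linarith
  have hfloor_le := Nat.floor_le (sub_nonneg.2 hx)
  have hlt_floor := Nat.lt_floor_add_one (x - X)
  have hlast := hstep (X + ⌊x - X⌋₊) (by simp) (x - (X + ⌊x - X⌋₊))
    ⟨by linarith, by linarith⟩
  rw [add_sub_cancel] at hlast
  have htri := abs_sub_le (f x) (f (X + ⌊x - X⌋₊)) (f X)
  nlinarith [hnat ⌊x - X⌋₊]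

theorem isLittleO_id_of_tendsto_sub {f : ℝ → ℝ} (hf : Measurable f)
    (hslow : ∀ u, Tendsto (fun x => f (x + u) - f x) atTop (𝓝 0)) : f =o[atTop] (id : ℝ → ℝ) := by
  refine isLittleO_iff.2 fun ε hε => ?_
  obtain ⟨X, hX⟩ :=
    eventually_atTop.1 (eventually_forall_abs_sub_le_of_tendsto hf hslow (half_pos hε))
  filter_upwards [eventually_ge_atTop X, eventually_ge_atTop 0,
    (tendsto_id.const_mul_atTop (half_pos hε)).eventually_ge_atTop
      (|f X| + ε / 2 * (1 - X))] with x hx hx0 hlarge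
  have hgrowth := abs_sub_le_of_forall_unit_step hX hx
  have htri := abs_sub_abs_le_abs_sub (f x) (f X)
  simp only [id_eq] at hlarge
  rw [id_eq, Real.norm_eq_abs, Real.norm_of_nonneg hx0]
  linarith

theorem SlowlyVarying.log_isLittleO {L : ℝ → ℝ} (hL : SlowlyVarying L) :
    (fun t => Real.log (L t)) =o[atTop] Real.log := by
  have hmeas : Measurable fun x => Real.log (L (Real.exp x)) :=
    Real.measurable_log.comp (hL.measurable.comp
      (f := fun x : ℝ => (⟨Real.exp x, Real.exp_pos x⟩ : Set.Ioi (0 : ℝ)))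
      Real.measurable_exp.subtype_mk)
  have hslow (u : ℝ) : Tendsto
      (fun x => Real.log (L (Real.exp (x + u))) - Real.log (L (Real.exp x))) atTop (𝓝 0) := by
    have hlim :=
      ((hL.tendsto (Real.exp u) (Real.exp_pos u)).comp Real.tendsto_exp_atTop).log one_ne_zero
    rw [Real.log_one] at hlim
    refine hlim.congr fun x => ?_
    rw [Function.comp_apply, Real.log_div (hL.pos _ (by positivity)).ne'
      (hL.pos _ (Real.exp_pos x)).ne', Real.exp_add, mul_comm]
  refine ((isLittleO_id_of_tendsto_sub hmeas hslow).comp_tendsto Real.tendsto_log_atTop).congr'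
    ?_ EventuallyEq.rfl
  filter_upwards [eventually_gt_atTop 0] with t ht
  rw [Function.comp_apply, Real.exp_log ht]

theorem SlowlyVarying.eventually_rpow_neg_le_and_le_rpow {L : ℝ → ℝ} (hL : SlowlyVarying L) {s : ℝ}
    (hs : 0 < s) : ∀ᶠ t in atTop, t ^ (-s) ≤ L t ∧ L t ≤ t ^ s := by
  filter_upwards [isLittleO_iff.1 hL.log_isLittleO hs, eventually_ge_atTop 1]
    with t hlog ht
  have ht0 : 0 < t := zero_lt_one.trans_le ht
  rw [Real.norm_eq_abs, Real.norm_of_nonneg (Real.log_nonneg ht), abs_le] at hlog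
  rw [← Real.log_le_log_iff (by positivity) (hL.pos t ht0),
    ← Real.log_le_log_iff (hL.pos t ht0) (by positivity), Real.log_rpow ht0, Real.log_rpow ht0]
  exact ⟨by linarith [hlog.1], hlog.2⟩

end SlowVariation

section Moments

open scoped ENNReal

variable {Ω Ω' : Type*} [MeasurableSpace Ω] [MeasurableSpace Ω'] {P : Measure Ω} {Q : Measure Ω'}
  {f g : Ω → ℝ}

/-- Finiteness of all moments of `f`: the class of random variables that contains the Gaussian ones
and is closed under polynomial operations. -/
def HasMoments (f : Ω → ℝ) (P : Measure Ω) : Prop := ∀ q : ℝ≥0∞, q ≠ ∞ → MemLp f q P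

theorem HasMoments.const [IsFiniteMeasure P] (c : ℝ) : HasMoments (fun _ => c) P :=
  fun _ _ => memLp_const c

theorem HasMoments.add (hf : HasMoments f P) (hg : HasMoments g P) :
    HasMoments (fun ω => f ω + g ω) P :=
  fun q hq => (hf q hq).add (hg q hq)

theorem HasMoments.mul (hf : HasMoments f P) (hg : HasMoments g P) :
    HasMoments (fun ω => f ω * g ω) P := by
  intro q hq
  have h2q : 2 * q ≠ ∞ := ENNReal.mul_ne_top (by norm_num) hq
  have : ENNReal.HolderTriple (2 * q) (2 * q) q := ⟨by
    rw [ENNReal.mul_inv (by simp) (by simp), ← add_mul, ENNReal.inv_two_add_inv_two, one_mul]⟩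
  exact (hg (2 * q) h2q).mul (hf (2 * q) h2q)

theorem HasMoments.prod [IsFiniteMeasure P] {ι : Type*} (s : Finset ι) {f : ι → Ω → ℝ}
    (hf : ∀ i ∈ s, HasMoments (f i) P) : HasMoments (fun ω => ∏ i ∈ s, f i ω) P := by
  classical
  induction s using Finset.induction_on with
  | empty => simpa using HasMoments.const 1
  | insert i s hi ih =>
    simp only [Finset.prod_insert hi]
    exact (hf i (by simp)).mul (ih fun j hj => hf j (by simp [hj]))

theorem HasMoments.eval [IsFiniteMeasure P] (hf : HasMoments f P) (p : Polynomial ℝ) :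
    HasMoments (fun ω => p.eval (f ω)) P := by
  induction p using Polynomial.induction_on' with
  | add p q hp hq => simpa using hp.add hq
  | monomial k a =>
    simp only [Polynomial.eval_monomial]
    refine (HasMoments.const a).mul ?_
    simpa using HasMoments.prod (Finset.range k) (f := fun _ => f) fun _ _ => hf

theorem HasMoments.integrable (hf : HasMoments f P) : Integrable f P :=
  memLp_one_iff_integrable.1 (hf 1 ENNReal.one_ne_top)

theorem HasMoments.comp {X : Ω' → Ω} (hX : AEMeasurable X Q) (hf : HasMoments f (Q.map X)) :
    HasMoments (fun ω => f (X ω)) Q :=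
  fun q hq => (hf q hq).comp_of_map hX

theorem HasMoments.of_hasGaussianLaw (hf : HasGaussianLaw f P) : HasMoments f P :=
  fun _ hq => hf.memLp hq

theorem hasMoments_id_gaussianReal : HasMoments (fun x => x) (gaussianReal 0 1) :=
  fun q hq => memLp_id_gaussianReal' q hq

end Moments

section Stein

theorem hasDerivAt_gaussianPDFReal_zero_one (x : ℝ) :
    HasDerivAt (gaussianPDFReal 0 1) (-(x * gaussianPDFReal 0 1 x)) x := by
  have hexponent :
      HasDerivAt (fun y : ℝ => -(y - 0) ^ 2 / (2 * ((1 : NNReal) : ℝ))) (-x) x := by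
    refine ((((hasDerivAt_id x).sub_const 0).pow 2).neg.div_const _).congr_deriv ?_
    simp only [id_eq, sub_zero, NNReal.coe_one]
    ring
  refine (hexponent.exp.const_mul (√(2 * Real.pi * ((1 : NNReal) : ℝ)))⁻¹).congr_deriv ?_
  simp only [gaussianPDFReal]
  ring

theorem integrable_eval_mul_gaussianPDFReal (p : Polynomial ℝ) :
    Integrable (fun x => p.eval x * gaussianPDFReal 0 1 x) := by
  have hint := (hasMoments_id_gaussianReal.eval p).integrable
  rw [gaussianReal_of_var_ne_zero _ one_ne_zero,
    integrable_withDensity_iff_integrable_smul' (measurable_gaussianPDF 0 1)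
      (by simp [gaussianPDF])] at hint
  simpa [mul_comm] using hint

theorem integral_mul_eval_gaussianReal (p : Polynomial ℝ) :
    ∫ x, x * p.eval x ∂(gaussianReal 0 1) = ∫ x, p.derivative.eval x ∂(gaussianReal 0 1) := by
  have hparts := integral_mul_deriv_eq_deriv_mul_of_integrable (u := fun x => p.eval x)
    (u' := fun x => p.derivative.eval x) (fun x _ => p.hasDerivAt x)
    (fun x _ => hasDerivAt_gaussianPDFReal_zero_one x)
    ((integrable_eval_mul_gaussianPDFReal (Polynomial.X * p)).neg.congr
      (Eventually.of_forall fun x => by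
        simp only [Pi.neg_apply, Pi.mul_apply, Polynomial.eval_mul, Polynomial.eval_X]
        ring))
    (integrable_eval_mul_gaussianPDFReal p.derivative) (integrable_eval_mul_gaussianPDFReal p)
  rw [integral_gaussianReal_eq_integral_smul one_ne_zero,
    integral_gaussianReal_eq_integral_smul one_ne_zero]
  simp only [smul_eq_mul]
  calc ∫ x, gaussianPDFReal 0 1 x * (x * p.eval x)
      = -∫ x, p.eval x * -(x * gaussianPDFReal 0 1 x) := by
        rw [← integral_neg]
        exact integral_congr_ae (Eventually.of_forall fun x => by ring)
    _ = ∫ x, gaussianPDFReal 0 1 x * p.derivative.eval x := by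
        rw [hparts, neg_neg]
        exact integral_congr_ae (Eventually.of_forall fun x => mul_comm _ _)

theorem integral_mul_eval_mul_eval_affine_gaussianReal (ρ w : ℝ) (p q : Polynomial ℝ) :
    ∫ x, x * p.eval x * q.eval (ρ * x + w) ∂(gaussianReal 0 1) =
      ∫ x, p.derivative.eval x * q.eval (ρ * x + w) ∂(gaussianReal 0 1) +
        ρ * ∫ x, p.eval x * q.derivative.eval (ρ * x + w) ∂(gaussianReal 0 1) := by
  have hint (a b : Polynomial ℝ) :
      Integrable (fun x => a.eval x * b.eval (ρ * x + w)) (gaussianReal 0 1) := by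
    have hpoly := (hasMoments_id_gaussianReal.eval
      (a * b.comp (Polynomial.C ρ * Polynomial.X + Polynomial.C w))).integrable
    simpa using hpoly
  rw [← integral_const_mul, ← integral_add (hint _ _) ((hint _ _).const_mul ρ)]
  convert integral_mul_eval_gaussianReal
    (p * q.comp (Polynomial.C ρ * Polynomial.X + Polynomial.C w)) using 3 with x x
  · simp [mul_assoc]
  · simp [Polynomial.derivative_comp]
    ring

variable {Ω : Type*} [MeasurableSpace Ω] {P : Measure Ω} {X Y W : Ω → ℝ}

theorem map_eq_gaussianReal_zero_one (hX : HasGaussianLaw X P) (hmean : ∫ ω, X ω ∂P = 0)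
    (hvar : variance X P = 1) : P.map X = gaussianReal 0 1 := by
  rw [hX.map_eq_gaussianReal, hmean, hvar, Real.toNNReal_one]

variable [IsProbabilityMeasure P]

theorem indepFun_sub_covariance_mul (hXY : HasGaussianLaw (fun ω => (X ω, Y ω)) P)
    (hvar : variance X P = 1) : IndepFun X (fun ω => Y ω - covariance X Y P * X ω) P := by
  have hpair : HasGaussianLaw (fun ω => (X ω, Y ω - covariance X Y P * X ω)) P := by
    simpa using hXY.map_fun ((ContinuousLinearMap.fst ℝ ℝ ℝ).prod
      (ContinuousLinearMap.snd ℝ ℝ ℝ - covariance X Y P • ContinuousLinearMap.fst ℝ ℝ ℝ))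
  refine hpair.indepFun_of_covariance_eq_zero ?_
  rw [covariance_fun_sub_right hXY.fst.memLp_two hXY.snd.memLp_two
    (hXY.fst.memLp_two.const_mul _), covariance_const_mul_right,
    covariance_self hXY.fst.aemeasurable, hvar, mul_one, sub_self]

theorem integrable_and_integral_comp_prodMk_of_indepFun (hX : AEMeasurable X P)
    (hW : AEMeasurable W P) (hindep : IndepFun X W P) {f : ℝ × ℝ → ℝ} (hf : Continuous f)
    (hint : Integrable (fun ω => f (X ω, W ω)) P) :
    Integrable (fun w => ∫ x, f (x, w) ∂(P.map X)) (P.map W) ∧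
      ∫ ω, f (X ω, W ω) ∂P = ∫ w, ∫ x, f (x, w) ∂(P.map X) ∂(P.map W) := by
  have hlaw := (indepFun_iff_map_prod_eq_prod_map_map hX hW).1 hindep
  have : IsProbabilityMeasure (P.map X) := Measure.isProbabilityMeasure_map hX
  have : IsProbabilityMeasure (P.map W) := Measure.isProbabilityMeasure_map hW
  have hprod : Integrable f ((P.map X).prod (P.map W)) := by
    rwa [← hlaw, integrable_map_measure hf.aestronglyMeasurable (hX.prodMk hW)]
  refine ⟨hprod.integral_prod_right, ?_⟩
  rw [← integral_prod_symm _ hprod, ← hlaw,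
    integral_map (hX.prodMk hW) hf.aestronglyMeasurable]

theorem integral_mul_eval_mul_eval (hXY : HasGaussianLaw (fun ω => (X ω, Y ω)) P)
    (hmean : ∫ ω, X ω ∂P = 0) (hvar : variance X P = 1) (p q : Polynomial ℝ) :
    ∫ ω, X ω * p.eval (X ω) * q.eval (Y ω) ∂P =
      ∫ ω, p.derivative.eval (X ω) * q.eval (Y ω) ∂P +
        covariance X Y P * ∫ ω, p.eval (X ω) * q.derivative.eval (Y ω) ∂P := by
  set ρ := covariance X Y P
  have hindep : IndepFun X (fun ω => Y ω - ρ * X ω) P := indepFun_sub_covariance_mul hXY hvar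
  have hX := hXY.fst.aemeasurable
  have hY := hXY.snd.aemeasurable
  have hfubini (a b : Polynomial ℝ) := integrable_and_integral_comp_prodMk_of_indepFun hX
    (hY.sub (hX.const_mul ρ)) hindep (f := fun z => a.eval z.1 * b.eval (ρ * z.1 + z.2))
    ((a.continuous.comp continuous_fst).mul (b.continuous.comp (by fun_prop)))
    (by simpa using (((HasMoments.of_hasGaussianLaw hXY.fst).eval a).mul
      ((HasMoments.of_hasGaussianLaw hXY.snd).eval b)).integrable)
  simp only [map_eq_gaussianReal_zero_one hXY.fst hmean hvar, Pi.sub_apply,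
    add_sub_cancel] at hfubini
  have hleft := (hfubini (Polynomial.X * p) q).2
  simp only [Polynomial.eval_mul, Polynomial.eval_X] at hleft
  rw [hleft, (hfubini p.derivative q).2, (hfubini p q.derivative).2, ← integral_const_mul,
    ← integral_add (hfubini p.derivative q).1 ((hfubini p q.derivative).1.const_mul ρ)]
  exact integral_congr_ae (Eventually.of_forall fun w =>
    integral_mul_eval_mul_eval_affine_gaussianReal ρ w p q)

end Stein

section Hermite

/-- The probabilists' Hermite polynomial `H_k` over `ℝ`; Mathlib's has integer coefficients. -/
noncomputable def realHermite (k : ℕ) : Polynomial ℝ :=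
  (Polynomial.hermite k).map (Int.castRingHom ℝ)

theorem aeval_hermite (k : ℕ) (x : ℝ) :
    Polynomial.aeval x (Polynomial.hermite k) = (realHermite k).eval x := by
  rw [realHermite, Polynomial.eval_map, Polynomial.aeval_def, algebraMap_int_eq]

theorem realHermite_zero : realHermite 0 = 1 := by simp [realHermite]

theorem realHermite_succ (k : ℕ) :
    realHermite (k + 1) = Polynomial.X * realHermite k - (realHermite k).derivative := by
  simp [realHermite, Polynomial.hermite_succ, Polynomial.derivative_map]

theorem monic_realHermite (k : ℕ) : (realHermite k).Monic :=
  (Polynomial.hermite_monic k).map _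

theorem natDegree_realHermite (k : ℕ) : (realHermite k).natDegree = k := by
  rw [realHermite, (Polynomial.hermite_monic k).natDegree_map, Polynomial.natDegree_hermite]

theorem derivative_realHermite_succ (k : ℕ) :
    (realHermite (k + 1)).derivative = ((k + 1 : ℕ) : Polynomial ℝ) * realHermite k := by
  induction k with
  | zero => simp [realHermite_succ, realHermite_zero]
  | succ k ih =>
    rw [realHermite_succ (k + 1), Polynomial.derivative_sub, Polynomial.derivative_mul, ih,
      Polynomial.derivative_X, Polynomial.derivative_natCast_mul, realHermite_succ k]
    push_cast
    ring

variable {Ω : Type*} [MeasurableSpace Ω] {P : Measure Ω} [IsProbabilityMeasure P] {X Y : Ω → ℝ}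

theorem integral_realHermite_succ_mul_eval (hXY : HasGaussianLaw (fun ω => (X ω, Y ω)) P)
    (hmean : ∫ ω, X ω ∂P = 0) (hvar : variance X P = 1) (k : ℕ) (q : Polynomial ℝ) :
    ∫ ω, (realHermite (k + 1)).eval (X ω) * q.eval (Y ω) ∂P =
      covariance X Y P * ∫ ω, (realHermite k).eval (X ω) * q.derivative.eval (Y ω) ∂P := by
  have hmX := HasMoments.of_hasGaussianLaw hXY.fst
  have hmY := HasMoments.of_hasGaussianLaw hXY.snd
  simp only [realHermite_succ k, Polynomial.eval_sub, Polynomial.eval_mul, Polynomial.eval_X,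
    sub_mul]
  rw [integral_sub ((hmX.mul (hmX.eval _)).mul (hmY.eval _)).integrable
    ((hmX.eval _).mul (hmY.eval _)).integrable,
    integral_mul_eval_mul_eval hXY hmean hvar, add_sub_cancel_left]

theorem integral_realHermite_mul_realHermite (hXY : HasGaussianLaw (fun ω => (X ω, Y ω)) P)
    (hmeanX : ∫ ω, X ω ∂P = 0) (hvarX : variance X P = 1)
    (hmeanY : ∫ ω, Y ω ∂P = 0) (hvarY : variance Y P = 1) (k l : ℕ) :
    ∫ ω, (realHermite k).eval (X ω) * (realHermite l).eval (Y ω) ∂P =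
      if k = l then k ! * covariance X Y P ^ k else 0 := by
  have hYX : HasGaussianLaw (fun ω => (Y ω, X ω)) P := by
    simpa using hXY.map_fun ((ContinuousLinearMap.snd ℝ ℝ ℝ).prod (ContinuousLinearMap.fst ℝ ℝ ℝ))
  induction k generalizing l with
  | zero =>
    cases l with
    | zero => simp [realHermite_zero]
    | succ l =>
      simpa [realHermite_zero] using integral_realHermite_succ_mul_eval hYX hmeanY hvarY l 1
  | succ k ih =>
    rw [integral_realHermite_succ_mul_eval hXY hmeanX hvarX]
    cases l with
    | zero => simp [realHermite_zero]
    | succ l =>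
      simp only [derivative_realHermite_succ, Polynomial.eval_mul, Polynomial.eval_natCast,
        mul_left_comm _ ((l + 1 : ℕ) : ℝ), integral_const_mul, ih l, add_left_inj]
      split_ifs with hkl
      · rw [hkl, Nat.factorial_succ, pow_succ]
        push_cast
        ring
      · simp

end Hermite

section Completeness

theorem ae_eq_zero_of_forall_integral_mul_cexp_eq_zero {E : Type*} [NormedAddCommGroup E]
    [NormedSpace ℝ E] [CompleteSpace E] [SecondCountableTopology E] [MeasurableSpace E]
    [BorelSpace E] {μ : Measure E} {g : E → ℝ} (hg : Integrable g μ)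
    (hzero : ∀ L : StrongDual ℝ E, ∫ w, (g w : ℂ) * Complex.exp (L w * Complex.I) ∂μ = 0) :
    g =ᵐ[μ] 0 := by
  have hfin {f : E → ℝ} (hf : Integrable f μ) : ∫⁻ w, ENNReal.ofReal (f w) ∂μ ≠ ⊤ :=
    ((lintegral_mono fun w => Real.ofReal_le_enorm (f w)).trans_lt hf.2).ne
  have hmeas_pos := hg.aemeasurable.ennreal_ofReal
  have hmeas_neg : AEMeasurable (fun w => ENNReal.ofReal (-g w)) μ :=
    hg.neg.aemeasurable.ennreal_ofReal
  have : IsFiniteMeasure (μ.withDensity fun w => ENNReal.ofReal (g w)) :=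
    isFiniteMeasure_withDensity (hfin hg)
  have : IsFiniteMeasure (μ.withDensity fun w => ENNReal.ofReal (-g w)) :=
    isFiniteMeasure_withDensity (hfin hg.neg)
  have hint (L : StrongDual ℝ E) {f : E → ℝ} (hf : Integrable f μ) :
      Integrable (fun w => f w • Complex.exp (L w * Complex.I)) μ :=
    hf.smul_bdd 1 (Continuous.aestronglyMeasurable (by fun_prop))
      (Eventually.of_forall fun w => by rw [Complex.norm_exp_ofReal_mul_I])
  have hparts : μ.withDensity (fun w => ENNReal.ofReal (g w)) =
      μ.withDensity fun w => ENNReal.ofReal (-g w) := by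
    refine Measure.ext_of_charFunDual (funext fun L => ?_)
    rw [charFunDual_apply, charFunDual_apply,
      integral_withDensity_eq_integral_toReal_smul₀ hmeas_pos (by simp),
      integral_withDensity_eq_integral_toReal_smul₀ hmeas_neg (by simp), ← sub_eq_zero,
      ← integral_sub (hint L (integrable_toReal_of_lintegral_ne_top hmeas_pos (hfin hg)))
        (hint L (integrable_toReal_of_lintegral_ne_top hmeas_neg (hfin hg.neg))), ← hzero L]
    refine integral_congr_ae (Eventually.of_forall fun w => ?_)
    simp only [← sub_smul, ENNReal.toReal_ofReal']
    rw [max_zero_sub_max_neg_zero_eq_self, Complex.real_smul]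
  filter_upwards [(withDensity_eq_iff hmeas_pos hmeas_neg (hfin hg)).1 hparts] with w hw
  have htoReal := congrArg ENNReal.toReal hw
  simp only [ENNReal.toReal_ofReal'] at htoReal
  rw [Pi.zero_apply, ← max_zero_sub_max_neg_zero_eq_self (g w), htoReal, sub_self]

theorem integral_mul_cexp_eq_zero_of_forall_integral_mul_pow_eq_zero {Ω : Type*}
    [MeasurableSpace Ω] {μ : Measure Ω} {g s : Ω → ℝ} (hg : AEStronglyMeasurable g μ)
    (hs : AEStronglyMeasurable s μ) (hint : Integrable (fun w => |g w| * Real.exp |s w|) μ)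
    (hzero : ∀ k : ℕ, ∫ w, g w * s w ^ k ∂μ = 0) :
    ∫ w, (g w : ℂ) * Complex.exp (s w * Complex.I) ∂μ = 0 := by
  have hexp (w : Ω) : HasSum (fun k : ℕ => |g w| * (|s w| ^ k / k !)) (|g w| * Real.exp |s w|) := by
    have := NormedSpace.expSeries_div_hasSum_exp (𝔸 := ℝ) |s w|
    rw [← Real.exp_eq_exp_ℝ] at this
    exact this.mul_left |g w|
  have hseries := hasSum_integral_of_dominated_convergence (μ := μ)
    (F := fun k w => Complex.I ^ k / k ! * ((g w * s w ^ k : ℝ) : ℂ))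
    (f := fun w => (g w : ℂ) * Complex.exp (s w * Complex.I))
    (fun k w => |g w| * (|s w| ^ k / k !))
    (fun k => (Complex.continuous_ofReal.comp_aestronglyMeasurable
      (hg.mul (hs.pow k))).const_mul _)
    (fun k => Eventually.of_forall fun w => by
      rw [norm_mul, norm_div, norm_pow, Complex.norm_I, one_pow, Complex.norm_natCast,
        Complex.norm_real, Real.norm_eq_abs, abs_mul, abs_pow]
      exact le_of_eq (by ring))
    (Eventually.of_forall fun w => (hexp w).summable)
    (hint.congr (Eventually.of_forall fun w => (hexp w).tsum_eq.symm))
    (Eventually.of_forall fun w => by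
      have := (NormedSpace.expSeries_div_hasSum_exp (𝔸 := ℂ) (s w * Complex.I)).mul_left (g w : ℂ)
      rw [← Complex.exp_eq_exp_ℂ] at this
      refine this.congr_fun fun k => ?_
      push_cast
      ring)
  refine hseries.unique (hasSum_zero.congr_fun fun k => ?_)
  rw [integral_const_mul, integral_complex_ofReal, hzero k, Complex.ofReal_zero, mul_zero]

end Completeness

section HermiteProducts

variable {ι : Type*} [Fintype ι] {F G : (ι → ℝ) → ℝ}

instance isProbabilityMeasure_stdGauss : IsProbabilityMeasure (stdGauss ι) := by
  unfold stdGauss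
  infer_instance

theorem map_eval_stdGauss (j : ι) : (stdGauss ι).map (fun w => w j) = gaussianReal 0 1 :=
  (measurePreserving_eval (fun _ : ι => gaussianReal 0 1) j).map_eq

theorem hasMoments_prod_eval_stdGauss (p : ι → Polynomial ℝ) :
    HasMoments (fun w : ι → ℝ => ∏ j, (p j).eval (w j)) (stdGauss ι) := by
  refine HasMoments.prod _ fun j _ => HasMoments.eval ?_ (p j)
  refine HasMoments.comp (f := fun x : ℝ => x) (measurable_pi_apply j).aemeasurable ?_
  rw [map_eval_stdGauss]
  exact hasMoments_id_gaussianReal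

theorem hermiteProd_eq_prod_eval (v : ι → ℕ) (w : ι → ℝ) :
    hermiteProd v w = ∏ j, (realHermite (v j)).eval (w j) := by
  simp only [hermiteProd, aeval_hermite]

theorem memLp_hermiteProd (v : ι → ℕ) : MemLp (hermiteProd v) 2 (stdGauss ι) := by
  simpa only [← hermiteProd_eq_prod_eval] using
    hasMoments_prod_eval_stdGauss (fun j => realHermite (v j)) 2 ENNReal.ofNat_ne_top

theorem multiFactorial_pos (v : ι → ℕ) : (0 : ℝ) < multiFactorial v :=
  Nat.cast_pos.2 (Finset.prod_pos fun j _ => Nat.factorial_pos (v j))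

theorem integral_realHermite_mul_realHermite_gaussianReal (k l : ℕ) :
    ∫ x, (realHermite k).eval x * (realHermite l).eval x ∂(gaussianReal 0 1) =
      if k = l then (k ! : ℝ) else 0 := by
  have hdiag : HasGaussianLaw (fun x : ℝ => (x, x)) (gaussianReal 0 1) :=
    (IsGaussian.hasGaussianLaw_id (μ := gaussianReal 0 1)).map_fun
      ((ContinuousLinearMap.id ℝ ℝ).prod (ContinuousLinearMap.id ℝ ℝ))
  have hvar : variance (fun x : ℝ => x) (gaussianReal 0 1) = 1 := by simp
  have hmean : ∫ x, x ∂(gaussianReal 0 1) = 0 := by simp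
  rw [integral_realHermite_mul_realHermite hdiag hmean hvar hmean hvar,
    covariance_self aemeasurable_id', hvar, one_pow, mul_one]

theorem integral_hermiteProd_mul_hermiteProd (v u : ι → ℕ) :
    ∫ w, hermiteProd v w * hermiteProd u w ∂(stdGauss ι) =
      if v = u then (multiFactorial v : ℝ) else 0 := by
  simp only [hermiteProd_eq_prod_eval, ← Finset.prod_mul_distrib, stdGauss]
  rw [integral_fintype_prod_eq_prod
    (fun j x => (realHermite (v j)).eval x * (realHermite (u j)).eval x)]
  simp only [integral_realHermite_mul_realHermite_gaussianReal, multiFactorial]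
  split_ifs with hvu
  · simp [hvu]
  · obtain ⟨j, hj⟩ := Function.ne_iff.1 hvu
    exact Finset.prod_eq_zero (Finset.mem_univ j) (if_neg hj)

theorem integrable_mul_hermiteProd (hG : MemLp G 2 (stdGauss ι)) (v : ι → ℕ) :
    Integrable (fun w => G w * hermiteProd v w) (stdGauss ι) :=
  hG.integrable_mul (memLp_hermiteProd v)

theorem hermiteCoeff_sub (hF : MemLp F 2 (stdGauss ι)) (hG : MemLp G 2 (stdGauss ι))
    (v : ι → ℕ) :
    hermiteCoeff (F - G) v = hermiteCoeff F v - hermiteCoeff G v := by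
  simp only [hermiteCoeff, Pi.sub_apply, sub_mul]
  exact integral_sub (integrable_mul_hermiteProd hF v) (integrable_mul_hermiteProd hG v)

theorem span_range_realHermite : Submodule.span ℝ (Set.range realHermite) = ⊤ := by
  let S : Polynomial.Sequence ℝ := ⟨realHermite, fun k => by
    rw [Polynomial.degree_eq_natDegree (monic_realHermite k).ne_zero, natDegree_realHermite]⟩
  exact S.span fun k => by
    rw [show (S k).leadingCoeff = 1 from monic_realHermite k]
    exact isUnit_one

theorem integral_mul_prod_eval_eq_zero (hG : MemLp G 2 (stdGauss ι))
    (hzero : ∀ v, hermiteCoeff G v = 0) (p : ι → Polynomial ℝ) :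
    ∫ w, G w * ∏ j, (p j).eval (w j) ∂(stdGauss ι) = 0 := by
  classical
  have hspan (j : ι) : ∃ c : ℕ →₀ ℝ, (c.sum fun k a => a • realHermite k) = p j :=
    Finsupp.mem_span_range_iff_exists_finsupp.1 (span_range_realHermite ▸ Submodule.mem_top)
  choose c hc using hspan
  have hexpand (w : ι → ℝ) : G w * ∏ j, (p j).eval (w j) =
      ∑ v ∈ Fintype.piFinset fun j => (c j).support,
        (∏ j, c j (v j)) * (G w * hermiteProd v w) := by
    simp only [← hc, Finsupp.sum, Polynomial.eval_finsetSum, Polynomial.eval_smul, smul_eq_mul]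
    rw [Finset.prod_univ_sum, Finset.mul_sum]
    refine Finset.sum_congr rfl fun v _ => ?_
    rw [Finset.prod_mul_distrib, hermiteProd_eq_prod_eval]
    ring
  simp only [hexpand]
  rw [integral_finsetSum _ fun v _ => (integrable_mul_hermiteProd hG v).const_mul _]
  refine Finset.sum_eq_zero fun v _ => ?_
  rw [integral_const_mul, ← hermiteCoeff, hzero v, mul_zero]

theorem integral_mul_dual_pow_eq_zero (hG : MemLp G 2 (stdGauss ι))
    (hzero : ∀ v, hermiteCoeff G v = 0) (L : StrongDual ℝ (ι → ℝ)) (k : ℕ) :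
    ∫ w, G w * L w ^ k ∂(stdGauss ι) = 0 := by
  classical
  have hexpand (w : ι → ℝ) : G w * L w ^ k = ∑ v ∈ Finset.piAntidiag Finset.univ k,
      (Nat.multinomial Finset.univ v * ∏ j, L (fun i => if j = i then 1 else 0) ^ v j) *
        (G w * ∏ j, (Polynomial.X ^ v j : Polynomial ℝ).eval (w j)) := by
    rw [← ContinuousLinearMap.coe_coe L, LinearMap.pi_apply_eq_sum_univ,
      Finset.sum_pow_eq_sum_piAntidiag, Finset.mul_sum]
    refine Finset.sum_congr rfl fun v _ => ?_
    simp only [smul_eq_mul, mul_pow, Finset.prod_mul_distrib, Polynomial.eval_pow,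
      Polynomial.eval_X, ContinuousLinearMap.coe_coe]
    ring
  have hint (p : ι → Polynomial ℝ) :
      Integrable (fun w => G w * ∏ j, (p j).eval (w j)) (stdGauss ι) :=
    hG.integrable_mul (hasMoments_prod_eval_stdGauss p 2 ENNReal.ofNat_ne_top)
  simp only [hexpand]
  rw [integral_finsetSum _ fun v _ => (hint fun j => Polynomial.X ^ v j).const_mul _]
  refine Finset.sum_eq_zero fun v _ => ?_
  rw [integral_const_mul, integral_mul_prod_eval_eq_zero hG hzero, mul_zero]

theorem memLp_exp_dual (L : StrongDual ℝ (ι → ℝ)) :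
    MemLp (fun w => Real.exp (L w)) 2 (stdGauss ι) := by
  classical
  rw [memLp_two_iff_integrable_sq (Continuous.aestronglyMeasurable (by fun_prop))]
  have hprod (w : ι → ℝ) : Real.exp (L w) ^ 2 =
      ∏ j, Real.exp (2 * L (fun i => if j = i then 1 else 0) * w j) := by
    rw [← Real.exp_sum, ← Real.exp_nat_mul, ← ContinuousLinearMap.coe_coe L,
      LinearMap.pi_apply_eq_sum_univ, Finset.mul_sum]
    refine congrArg Real.exp (Finset.sum_congr rfl fun j _ => ?_)
    rw [smul_eq_mul, Nat.cast_ofNat, ContinuousLinearMap.coe_coe]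
    ring
  simp only [hprod]
  exact Integrable.fintype_prod fun j => integrable_exp_mul_gaussianReal _

theorem ae_eq_zero_of_forall_hermiteCoeff_eq_zero (hG : MemLp G 2 (stdGauss ι))
    (hzero : ∀ v, hermiteCoeff G v = 0) : G =ᵐ[stdGauss ι] 0 := by
  refine ae_eq_zero_of_forall_integral_mul_cexp_eq_zero (hG.integrable one_le_two) fun L =>
    integral_mul_cexp_eq_zero_of_forall_integral_mul_pow_eq_zero hG.1
      (Continuous.aestronglyMeasurable (by fun_prop)) ?_ (integral_mul_dual_pow_eq_zero hG hzero L)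
  refine (hG.abs.integrable_mul ((memLp_exp_dual L).add (memLp_exp_dual (-L)))).mono'
    (hG.abs.1.mul (Continuous.aestronglyMeasurable (by fun_prop)))
    (Eventually.of_forall fun w => ?_)
  rw [Real.norm_of_nonneg (by positivity)]
  exact mul_le_mul_of_nonneg_left (Real.exp_abs_le (L w)) (abs_nonneg _)

end HermiteProducts

section HermiteExpansion

theorem real_inner_toLp_toLp {Ω : Type*} [MeasurableSpace Ω] {μ : Measure Ω} {f g : Ω → ℝ}
    (hf : MemLp f 2 μ) (hg : MemLp g 2 μ) :
    inner ℝ (hf.toLp f) (hg.toLp g) = ∫ w, f w * g w ∂μ := by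
  rw [L2.inner_def]
  refine integral_congr_ae ?_
  filter_upwards [hf.coeFn_toLp, hg.coeFn_toLp] with w hfw hgw
  simp [hfw, hgw, mul_comm]

theorem norm_toLp_sq {Ω : Type*} [MeasurableSpace Ω] {μ : Measure Ω} {f : Ω → ℝ}
    (hf : MemLp f 2 μ) : ‖hf.toLp f‖ ^ 2 = ∫ w, f w ^ 2 ∂μ := by
  rw [← real_inner_self_eq_norm_sq, real_inner_toLp_toLp hf hf]
  simp only [pow_two]

theorem hasSum_norm_sq_of_pairwise_inner_eq_zero {T H : Type*} [NormedAddCommGroup H]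
    [InnerProductSpace ℝ H] {f : T → H} {z : H} (hf : HasSum f z)
    (horth : Pairwise fun i j => inner ℝ (f i) (f j) = 0) :
    HasSum (fun i => ‖f i‖ ^ 2) (‖z‖ ^ 2) := by
  have hcoeff (i : T) : inner ℝ z (f i) = ‖f i‖ ^ 2 := by
    have hsum := hf.mapL (innerSL ℝ (f i))
    have hsingle := hasSum_single i fun j (hji : j ≠ i) => horth hji.symm
    rw [real_inner_comm, ← real_inner_self_eq_norm_sq]
    exact hsum.unique hsingle
  simpa only [innerSL_apply_apply, hcoeff, real_inner_self_eq_norm_sq] using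
    hf.mapL (innerSL ℝ z)

variable {ι : Type*} [Fintype ι] {F G : (ι → ℝ) → ℝ}

/-- The Hermite product `e_v` as an element of `L²` of the Gaussian measure. -/
noncomputable def hermiteLp (v : ι → ℕ) : Lp ℝ 2 (stdGauss ι) :=
  (memLp_hermiteProd v).toLp (hermiteProd v)

theorem inner_hermiteLp_toLp (hG : MemLp G 2 (stdGauss ι)) (v : ι → ℕ) :
    inner ℝ (hermiteLp v) (hG.toLp G) = hermiteCoeff G v := by
  rw [hermiteLp, real_inner_comm, real_inner_toLp_toLp, hermiteCoeff]

theorem inner_hermiteLp_hermiteLp (v u : ι → ℕ) :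
    inner ℝ (hermiteLp v) (hermiteLp u) = if v = u then (multiFactorial v : ℝ) else 0 := by
  rw [hermiteLp, hermiteLp, real_inner_toLp_toLp, integral_hermiteProd_mul_hermiteProd]

theorem norm_hermiteLp_sq (v : ι → ℕ) : ‖hermiteLp v‖ ^ 2 = (multiFactorial v : ℝ) := by
  rw [← real_inner_self_eq_norm_sq, inner_hermiteLp_hermiteLp, if_pos rfl]

theorem norm_hermiteLp_ne_zero (v : ι → ℕ) : ‖hermiteLp v‖ ≠ 0 := by
  have hpos := (norm_hermiteLp_sq v).symm ▸ multiFactorial_pos v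
  exact (pow_ne_zero_iff two_ne_zero).1 hpos.ne'

theorem orthonormal_normalize_hermiteLp :
    Orthonormal ℝ fun v : ι → ℕ => normalize (hermiteLp v) := by
  refine ⟨fun v => ?_, fun v u hvu => ?_⟩
  · exact norm_normalize (norm_ne_zero_iff.1 (norm_hermiteLp_ne_zero v))
  · beta_reduce
    rw [NormedSpace.normalize, NormedSpace.normalize, real_inner_smul_left, real_inner_smul_right,
      inner_hermiteLp_hermiteLp, if_neg hvu, mul_zero, mul_zero]

theorem orthogonal_span_normalize_hermiteLp_eq_bot :
    (Submodule.span ℝ (Set.range fun v : ι → ℕ => normalize (hermiteLp v)))ᗮ = ⊥ := by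
  refine (Submodule.eq_bot_iff _).2 fun f hf => ?_
  have hcoeff (v : ι → ℕ) : hermiteCoeff f v = 0 := by
    have hortho := (Submodule.mem_orthogonal _ f).1 hf _ (Submodule.subset_span ⟨v, rfl⟩)
    beta_reduce at hortho
    rw [NormedSpace.normalize, real_inner_smul_left, ← Lp.toLp_coeFn f (Lp.memLp f),
      inner_hermiteLp_toLp] at hortho
    exact (mul_eq_zero.1 hortho).resolve_left (inv_ne_zero (norm_hermiteLp_ne_zero v))
  exact Lp.eq_zero_iff_ae_eq_zero.2
    (ae_eq_zero_of_forall_hermiteCoeff_eq_zero (Lp.memLp f) hcoeff)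

/-- The Hilbert basis of `L²` of the Gaussian measure formed by the normalized Hermite products. -/
noncomputable def hermiteBasis (ι : Type*) [Fintype ι] :
    HilbertBasis (ι → ℕ) ℝ (Lp ℝ 2 (stdGauss ι)) :=
  HilbertBasis.mkOfOrthogonalEqBot orthonormal_normalize_hermiteLp
    orthogonal_span_normalize_hermiteLp_eq_bot

theorem hasSum_hermiteLp (hG : MemLp G 2 (stdGauss ι)) :
    HasSum (fun v => (hermiteCoeff G v / (multiFactorial v : ℝ)) • hermiteLp v) (hG.toLp G) := by
  refine ((hermiteBasis ι).hasSum_repr (hG.toLp G)).congr_fun fun v => ?_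
  rw [HilbertBasis.repr_apply_apply, hermiteBasis, HilbertBasis.coe_mkOfOrthogonalEqBot,
    NormedSpace.normalize, real_inner_smul_left, inner_hermiteLp_toLp, smul_smul,
    ← norm_hermiteLp_sq]
  congr 1
  ring

theorem hasSum_hermiteCoeff_sq_div (hG : MemLp G 2 (stdGauss ι)) :
    HasSum (fun v => hermiteCoeff G v ^ 2 / (multiFactorial v : ℝ))
      (∫ w, G w ^ 2 ∂(stdGauss ι)) := by
  rw [← norm_toLp_sq hG]
  refine (hasSum_norm_sq_of_pairwise_inner_eq_zero (hasSum_hermiteLp hG)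
    fun v u hvu => ?_).congr_fun fun v => ?_
  · beta_reduce
    rw [real_inner_smul_left, real_inner_smul_right, inner_hermiteLp_hermiteLp, if_neg hvu,
      mul_zero, mul_zero]
  · have := multiFactorial_pos v
    rw [norm_smul, mul_pow, norm_hermiteLp_sq, Real.norm_eq_abs, sq_abs]
    field_simp

/-- The partial sum over `S` of the Hermite expansion of `G`. -/
noncomputable def hermitePartial (G : (ι → ℝ) → ℝ) (S : Finset (ι → ℕ)) (w : ι → ℝ) : ℝ :=
  ∑ v ∈ S, hermiteCoeff G v / (multiFactorial v : ℝ) * hermiteProd v w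

theorem memLp_hermitePartial (G : (ι → ℝ) → ℝ) (S : Finset (ι → ℕ)) :
    MemLp (hermitePartial G S) 2 (stdGauss ι) :=
  memLp_finsetSum _ fun v _ => (memLp_hermiteProd v).const_mul _

theorem hermiteCoeff_hermitePartial (G : (ι → ℝ) → ℝ) (S : Finset (ι → ℕ)) (v : ι → ℕ) :
    hermiteCoeff (hermitePartial G S) v = if v ∈ S then hermiteCoeff G v else 0 := by
  simp only [hermiteCoeff, hermitePartial, Finset.sum_mul, mul_assoc]
  rw [integral_finsetSum _ fun u _ =>
    (integrable_mul_hermiteProd (memLp_hermiteProd u) v).const_mul _]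
  simp only [integral_const_mul, integral_hermiteProd_mul_hermiteProd, mul_ite, mul_zero,
    Finset.sum_ite_eq', div_mul_cancel₀ _ (multiFactorial_pos v).ne']

end HermiteExpansion

section RandomFields

variable {E Ω X : Type*} [MeasurableSpace E] [MeasurableSpace Ω] [MeasurableSpace X]

theorem sq_integral_le_measureReal_univ_mul {μ : Measure X} [IsFiniteMeasure μ] {f : X → ℝ}
    (hf : MemLp f 2 μ) : (∫ x, f x ∂μ) ^ 2 ≤ μ.real Set.univ * ∫ x, f x ^ 2 ∂μ := by
  have hone : MemLp (fun _ : X => (1 : ℝ)) 2 μ := memLp_const 1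
  have hcs := real_inner_mul_inner_self_le (hone.toLp _) (hf.toLp f)
  simp only [real_inner_toLp_toLp, one_mul, integral_const, smul_eq_mul, mul_one] at hcs
  simpa only [pow_two] using hcs

variable {μ : Measure X} {P : Measure Ω}

theorem ae_sq_integral_prodMk_le [IsFiniteMeasure μ] [SFinite P] {f : X × Ω → ℝ}
    (hf : MemLp f 2 (μ.prod P)) :
    ∀ᵐ ω ∂P, (∫ x, f (x, ω) ∂μ) ^ 2 ≤ μ.real Set.univ * ∫ x, f (x, ω) ^ 2 ∂μ := by
  filter_upwards [hf.aestronglyMeasurable.prodMk_right, hf.integrable_sq.prod_left_ae]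
    with ω hmeas hsq
  exact sq_integral_le_measureReal_univ_mul ((memLp_two_iff_integrable_sq hmeas).2 hsq)

theorem memLp_integral_prod_left [IsFiniteMeasure μ] [IsFiniteMeasure P] {f : X × Ω → ℝ}
    (hf : MemLp f 2 (μ.prod P)) : MemLp (fun ω => ∫ x, f (x, ω) ∂μ) 2 P := by
  have hmeas := (hf.integrable one_le_two).integral_prod_right.aestronglyMeasurable
  refine (memLp_two_iff_integrable_sq hmeas).2
    ((hf.integrable_sq.integral_prod_right.const_mul (μ.real Set.univ)).mono' (hmeas.pow 2) ?_)
  filter_upwards [ae_sq_integral_prodMk_le hf] with ω hω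
  rwa [Real.norm_of_nonneg (sq_nonneg _)]

theorem integral_sq_integral_prod_left_le [IsFiniteMeasure μ] [IsFiniteMeasure P] {f : X × Ω → ℝ}
    (hf : MemLp f 2 (μ.prod P)) :
    ∫ ω, (∫ x, f (x, ω) ∂μ) ^ 2 ∂P ≤ μ.real Set.univ * ∫ p, f p ^ 2 ∂(μ.prod P) := by
  rw [integral_prod_symm _ hf.integrable_sq, ← integral_const_mul]
  exact integral_mono_ae (memLp_integral_prod_left hf).integrable_sq
    (hf.integrable_sq.integral_prod_right.const_mul _) (ae_sq_integral_prodMk_le hf)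

/-- A jointly measurable random field all of whose values have the same law `ν`. -/
structure HasMarginalLaw (ξ : X → Ω → E) (P : Measure Ω) (ν : Measure E) : Prop where
  measurable : Measurable fun p : X × Ω => ξ p.1 p.2
  map_eq : ∀ x, P.map (ξ x) = ν

/-- The integral of `F` along the field `ξ`, as a random variable. -/
noncomputable def fieldIntegral (ξ : X → Ω → E) (μ : Measure X) (F : E → ℝ) (ω : Ω) : ℝ :=
  ∫ x, F (ξ x ω) ∂μ

namespace HasMarginalLaw

variable {ξ : X → Ω → E} {ν : Measure E} {F H : E → ℝ}

theorem measurable_eval (hξ : HasMarginalLaw ξ P ν) (x : X) : Measurable (ξ x) :=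
  hξ.measurable.comp measurable_prodMk_left

theorem comp {Y : Type*} [MeasurableSpace Y] (hξ : HasMarginalLaw ξ P ν) {g : Y → X}
    (hg : Measurable g) : HasMarginalLaw (fun y => ξ (g y)) P ν where
  measurable := hξ.measurable.comp ((hg.comp measurable_fst).prodMk measurable_snd)
  map_eq y := hξ.map_eq (g y)

theorem map_uncurry [SFinite P] (hξ : HasMarginalLaw ξ P ν) :
    (μ.prod P).map (fun p => ξ p.1 p.2) = μ Set.univ • ν := by
  ext N hN
  have hslice (x : X) : P (Prod.mk x ⁻¹' ((fun p : X × Ω => ξ p.1 p.2) ⁻¹' N)) = ν N := by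
    rw [← hξ.map_eq x, Measure.map_apply (hξ.measurable_eval x) hN]
    rfl
  rw [Measure.map_apply hξ.measurable hN, Measure.prod_apply (hξ.measurable hN)]
  simp [hslice, mul_comm]

theorem memLp_uncurry [IsFiniteMeasure μ] [SFinite P] (hξ : HasMarginalLaw ξ P ν)
    (hF : MemLp F 2 ν) : MemLp (fun p : X × Ω => F (ξ p.1 p.2)) 2 (μ.prod P) := by
  refine MemLp.comp_of_map ?_ hξ.measurable.aemeasurable
  rw [hξ.map_uncurry]
  exact hF.smul_measure (measure_ne_top _ _)

theorem integral_sq_uncurry [SFinite P] (hξ : HasMarginalLaw ξ P ν) (hF : MemLp F 2 ν) :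
    ∫ p, F (ξ p.1 p.2) ^ 2 ∂(μ.prod P) = μ.real Set.univ * ∫ w, F w ^ 2 ∂ν := by
  have hmeas : AEStronglyMeasurable (fun w => F w ^ 2)
      ((μ.prod P).map fun p => ξ p.1 p.2) := by
    rw [hξ.map_uncurry]
    exact (hF.aestronglyMeasurable.pow 2).smul_measure _
  rw [← integral_map hξ.measurable.aemeasurable hmeas, hξ.map_uncurry, integral_smul_measure]
  rfl

variable [IsFiniteMeasure μ] [IsFiniteMeasure P]

theorem ae_integrable (hξ : HasMarginalLaw ξ P ν) (hF : MemLp F 2 ν) :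
    ∀ᵐ ω ∂P, Integrable (fun x => F (ξ x ω)) μ :=
  ((hξ.memLp_uncurry hF).integrable one_le_two).prod_left_ae

theorem memLp_fieldIntegral (hξ : HasMarginalLaw ξ P ν) (hF : MemLp F 2 ν) :
    MemLp (fieldIntegral ξ μ F) 2 P :=
  memLp_integral_prod_left (hξ.memLp_uncurry hF)

theorem integral_fieldIntegral_sq_le (hξ : HasMarginalLaw ξ P ν) (hF : MemLp F 2 ν) :
    ∫ ω, fieldIntegral ξ μ F ω ^ 2 ∂P ≤ μ.real Set.univ ^ 2 * ∫ w, F w ^ 2 ∂ν := by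
  rw [pow_two, mul_assoc, ← hξ.integral_sq_uncurry hF]
  exact integral_sq_integral_prod_left_le (hξ.memLp_uncurry hF)

theorem integral_fieldIntegral (hξ : HasMarginalLaw ξ P ν) (hF : MemLp F 2 ν) :
    ∫ ω, fieldIntegral ξ μ F ω ∂P = μ.real Set.univ * ∫ w, F w ∂ν := by
  have hmean (x : X) : ∫ ω, F (ξ x ω) ∂P = ∫ w, F w ∂ν := by
    rw [← hξ.map_eq x, integral_map (hξ.measurable_eval x).aemeasurable]
    rw [hξ.map_eq x]
    exact hF.aestronglyMeasurable
  simp only [fieldIntegral]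
  rw [← integral_integral_swap ((hξ.memLp_uncurry hF).integrable one_le_two)]
  simp only [hmean, integral_const, smul_eq_mul]

theorem fieldIntegral_congr (hξ : HasMarginalLaw ξ P ν) (hFH : F =ᵐ[ν] H) :
    fieldIntegral ξ μ F =ᵐ[P] fieldIntegral ξ μ H := by
  have hac : (μ.prod P).map (fun p => ξ p.1 p.2) ≪ ν :=
    hξ.map_uncurry (μ := μ) ▸ Measure.smul_absolutelyContinuous
  have hprod := ae_of_ae_map hξ.measurable.aemeasurable (hac.ae_le hFH)
  filter_upwards [Measure.ae_ae_of_ae_prod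
    (Measure.measurePreserving_swap.quasiMeasurePreserving.ae hprod)] with ω hω
  exact integral_congr_ae hω

theorem fieldIntegral_add (hξ : HasMarginalLaw ξ P ν) (hF : MemLp F 2 ν) (hH : MemLp H 2 ν) :
    fieldIntegral ξ μ (F + H) =ᵐ[P] fieldIntegral ξ μ F + fieldIntegral ξ μ H := by
  filter_upwards [hξ.ae_integrable (μ := μ) hF, hξ.ae_integrable (μ := μ) hH] with ω hFω hHω
  exact integral_add hFω hHω

theorem fieldIntegral_sub (hξ : HasMarginalLaw ξ P ν) (hF : MemLp F 2 ν) (hH : MemLp H 2 ν) :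
    fieldIntegral ξ μ (F - H) =ᵐ[P] fieldIntegral ξ μ F - fieldIntegral ξ μ H := by
  filter_upwards [hξ.ae_integrable (μ := μ) hF, hξ.ae_integrable (μ := μ) hH] with ω hFω hHω
  exact integral_sub hFω hHω

theorem integral_fieldIntegral_mul (hξ : HasMarginalLaw ξ P ν) (hF : MemLp F 2 ν)
    (hH : MemLp H 2 ν) :
    ∫ ω, fieldIntegral ξ μ F ω * fieldIntegral ξ μ H ω ∂P =
      ∫ z, ∫ ω, F (ξ z.1 ω) * H (ξ z.2 ω) ∂P ∂(μ.prod μ) := by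
  have hint : Integrable (fun p : (X × X) × Ω => F (ξ p.1.1 p.2) * H (ξ p.1.2 p.2))
      ((μ.prod μ).prod P) :=
    ((hξ.comp measurable_fst).memLp_uncurry hF).integrable_mul
      ((hξ.comp measurable_snd).memLp_uncurry hH)
  rw [integral_integral_swap hint]
  exact integral_congr_ae (Eventually.of_forall fun ω =>
    (integral_prod_mul (fun x => F (ξ x ω)) fun x => H (ξ x ω)).symm)

/-- `F ↦ fieldIntegral ξ μ F` as a bounded operator from `L²(ν)` to `L²(P)`. -/
noncomputable def fieldIntegralL (hξ : HasMarginalLaw ξ P ν) (μ : Measure X) [IsFiniteMeasure μ] :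
    Lp ℝ 2 ν →L[ℝ] Lp ℝ 2 P :=
  LinearMap.mkContinuous
    { toFun := fun f => (hξ.memLp_fieldIntegral (Lp.memLp f)).toLp (fieldIntegral ξ μ f)
      map_add' := fun f g => by
        rw [← MemLp.toLp_add, MemLp.toLp_eq_toLp_iff]
        exact (hξ.fieldIntegral_congr (Lp.coeFn_add f g)).trans
          (hξ.fieldIntegral_add (Lp.memLp f) (Lp.memLp g))
      map_smul' := fun c f => by
        rw [RingHom.id_apply, ← MemLp.toLp_const_smul, MemLp.toLp_eq_toLp_iff]
        refine (hξ.fieldIntegral_congr (Lp.coeFn_smul c f)).trans (Eventually.of_forall fun ω => ?_)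
        exact integral_const_mul c _ }
    (μ.real Set.univ) fun f => by
      refine abs_le_of_sq_le_sq' ?_ (by positivity) |>.2
      rw [mul_pow, LinearMap.coe_mk, AddHom.coe_mk, norm_toLp_sq]
      nth_rw 2 [← Lp.toLp_coeFn f (Lp.memLp f)]
      rw [norm_toLp_sq]
      exact hξ.integral_fieldIntegral_sq_le (Lp.memLp f)

theorem fieldIntegralL_toLp (hξ : HasMarginalLaw ξ P ν) (hF : MemLp F 2 ν) :
    hξ.fieldIntegralL μ (hF.toLp F) =
      (hξ.memLp_fieldIntegral hF).toLp (fieldIntegral ξ μ F) :=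
  MemLp.toLp_congr (hξ.memLp_fieldIntegral (Lp.memLp _)) _
    (hξ.fieldIntegral_congr hF.coeFn_toLp)

end HasMarginalLaw

end RandomFields

section HermiteFieldIntegral

variable {ι Ω X : Type*} [Fintype ι] [MeasurableSpace Ω] [MeasurableSpace X] {P : Measure Ω}
  [IsFiniteMeasure P] {μ : Measure X} [IsFiniteMeasure μ] {ξ : X → Ω → ι → ℝ}

theorem HasMarginalLaw.fieldIntegral_hermitePartial (hξ : HasMarginalLaw ξ P (stdGauss ι))
    (G : (ι → ℝ) → ℝ) (S : Finset (ι → ℕ)) :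
    fieldIntegral ξ μ (hermitePartial G S) =ᵐ[P] fun ω =>
      ∑ v ∈ S, hermiteCoeff G v / (multiFactorial v : ℝ) * fieldIntegral ξ μ (hermiteProd v) ω := by
  have hint : ∀ᵐ ω ∂P, ∀ v ∈ S, Integrable (fun x => hermiteProd v (ξ x ω)) μ :=
    (Finset.eventually_all S).2 fun v _ => hξ.ae_integrable (memLp_hermiteProd v)
  filter_upwards [hint] with ω hω
  simp only [fieldIntegral, hermitePartial]
  rw [integral_finsetSum _ fun v hv => (hω v hv).const_mul _]
  simp only [integral_const_mul]

theorem HasMarginalLaw.inner_fieldIntegralL_hermiteLp (hξ : HasMarginalLaw ξ P (stdGauss ι))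
    (v u : ι → ℕ) :
    inner ℝ (hξ.fieldIntegralL μ (hermiteLp v)) (hξ.fieldIntegralL μ (hermiteLp u)) =
      ∫ z, ∫ ω, hermiteProd v (ξ z.1 ω) * hermiteProd u (ξ z.2 ω) ∂P ∂(μ.prod μ) := by
  rw [hermiteLp, hermiteLp, hξ.fieldIntegralL_toLp, hξ.fieldIntegralL_toLp, real_inner_toLp_toLp,
    hξ.integral_fieldIntegral_mul (memLp_hermiteProd v) (memLp_hermiteProd u)]

theorem HasMarginalLaw.hasSum_integral_fieldIntegral_sq (hξ : HasMarginalLaw ξ P (stdGauss ι))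
    {c : (ι → ℕ) → X × X → ℝ}
    (hc : ∀ v u x y, ∫ ω, hermiteProd v (ξ x ω) * hermiteProd u (ξ y ω) ∂P =
      if v = u then (multiFactorial v : ℝ) * c v (x, y) else 0)
    {G : (ι → ℝ) → ℝ} (hG : MemLp G 2 (stdGauss ι)) :
    HasSum (fun v => hermiteCoeff G v ^ 2 / (multiFactorial v : ℝ) * ∫ z, c v z ∂(μ.prod μ))
      (∫ ω, fieldIntegral ξ μ G ω ^ 2 ∂P) := by
  have hsum := hasSum_norm_sq_of_pairwise_inner_eq_zero
    ((hasSum_hermiteLp hG).mapL (hξ.fieldIntegralL μ)) fun v u hvu => by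
      beta_reduce
      rw [map_smul, map_smul, real_inner_smul_left, real_inner_smul_right,
        hξ.inner_fieldIntegralL_hermiteLp]
      simp only [hc, if_neg hvu, integral_zero, mul_zero]
  rw [hξ.fieldIntegralL_toLp, norm_toLp_sq] at hsum
  refine hsum.congr_fun fun v => ?_
  rw [map_smul, norm_smul, mul_pow, ← real_inner_self_eq_norm_sq (hξ.fieldIntegralL μ _),
    hξ.inner_fieldIntegralL_hermiteLp, Real.norm_eq_abs, sq_abs]
  simp only [hc, if_true, integral_const_mul]
  field_simp [(multiFactorial_pos v).ne']

end HermiteFieldIntegral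

section StrongWeakField

variable {d m n : ℕ} {Ω : Type*} [MeasurableSpace Ω] {P : Measure Ω}
  {α β : ℝ} {L₁ L₂ : ℝ → ℝ} {η : EuclideanSpace ℝ (Fin d) → Ω → (Fin m ⊕ Fin n → ℝ)}

/-- The correlation of `e_v(η(y + x))` and `e_v(η(y))`, for a field with covariance `covMatrix`. -/
noncomputable def covProd (α β : ℝ) (L₁ L₂ : ℝ → ℝ) (v : Fin m ⊕ Fin n → ℕ)
    (x : EuclideanSpace ℝ (Fin d)) : ℝ :=
  ∏ j, covMatrix m n α β L₁ L₂ x j j ^ v j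

namespace IsStrongWeakField

theorem hasGaussianLaw_pair (hη : IsStrongWeakField P α β L₁ L₂ η)
    (x y : EuclideanSpace ℝ (Fin d)) (j : Fin m ⊕ Fin n) :
    HasGaussianLaw (fun ω => (η x ω j, η y ω j)) P :=
  (hη.gaussian.hasGaussianLaw_prodMk (s := x) (t := y)).map_fun
    (((ContinuousLinearMap.proj j : (Fin m ⊕ Fin n → ℝ) →L[ℝ] ℝ).prodMap
      (ContinuousLinearMap.proj j : (Fin m ⊕ Fin n → ℝ) →L[ℝ] ℝ)))

theorem variance_eq_one (hη : IsStrongWeakField P α β L₁ L₂ η)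
    (x : EuclideanSpace ℝ (Fin d)) (j : Fin m ⊕ Fin n) : variance (fun ω => η x ω j) P = 1 := by
  rw [← covariance_self (hη.hasGaussianLaw_pair x x j).fst.aemeasurable, hη.cov_eq]
  simp [covMatrix]

variable [IsProbabilityMeasure P]

theorem covMatrix_le_one (hη : IsStrongWeakField P α β L₁ L₂ η)
    (x : EuclideanSpace ℝ (Fin d)) (j : Fin m ⊕ Fin n) : covMatrix m n α β L₁ L₂ x j j ≤ 1 := by
  have hgauss := hη.hasGaussianLaw_pair x 0 j
  have hnonneg := variance_nonneg ((fun ω => η x ω j) - fun ω => η 0 ω j) P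
  rw [variance_sub hgauss.fst.memLp_two hgauss.snd.memLp_two, hη.variance_eq_one,
    hη.variance_eq_one, hη.cov_eq, sub_zero] at hnonneg
  linarith

theorem hasMarginalLaw (hη : IsStrongWeakField P α β L₁ L₂ η) :
    HasMarginalLaw η P (stdGauss (Fin m ⊕ Fin n)) where
  measurable := hη.measurable
  map_eq x := by
    have hgauss (j : Fin m ⊕ Fin n) := (hη.hasGaussianLaw_pair x x j).fst
    have hindep : iIndepFun (fun j ω => η x ω j) P :=
      hη.indep.comp (fun _ path => path x) fun _ => measurable_pi_apply x
    refine ((iIndepFun_iff_map_fun_eq_pi_map fun j => (hgauss j).aemeasurable).1 hindep).trans ?_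
    simp only [stdGauss, fun j =>
      map_eq_gaussianReal_zero_one (hgauss j) (hη.mean_zero x j) (hη.variance_eq_one x j)]

theorem integral_hermiteProd_mul_hermiteProd (hη : IsStrongWeakField P α β L₁ L₂ η)
    (v u : Fin m ⊕ Fin n → ℕ) (x y : EuclideanSpace ℝ (Fin d)) :
    ∫ ω, hermiteProd v (η x ω) * hermiteProd u (η y ω) ∂P =
      if v = u then (multiFactorial v : ℝ) * covProd α β L₁ L₂ v (x - y) else 0 := by
  have hindep : iIndepFun (fun (j : Fin m ⊕ Fin n) ω => (η x ω j, η y ω j)) P :=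
    hη.indep.comp (fun _ path => (path x, path y)) fun _ => by fun_prop
  simp only [hermiteProd_eq_prod_eval, ← Finset.prod_mul_distrib]
  rw [hindep.integral_fun_prod_comp
    (f := fun j (z : ℝ × ℝ) => (realHermite (v j)).eval z.1 * (realHermite (u j)).eval z.2)
    (fun j => (hη.hasGaussianLaw_pair x y j).aemeasurable)
    (fun j => (((realHermite (v j)).continuous.comp continuous_fst).mul
      ((realHermite (u j)).continuous.comp continuous_snd)).aestronglyMeasurable)]
  simp only [fun j => integral_realHermite_mul_realHermite (hη.hasGaussianLaw_pair x y j)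
    (hη.mean_zero x j) (hη.variance_eq_one x j) (hη.mean_zero y j) (hη.variance_eq_one y j)
    (v j) (u j), hη.cov_eq]
  split_ifs with hvu
  · subst hvu
    simp [Finset.prod_mul_distrib, multiFactorial, covProd]
  · obtain ⟨j, hj⟩ := Function.ne_iff.1 hvu
    exact Finset.prod_eq_zero (Finset.mem_univ j) (if_neg hj)

end IsStrongWeakField

end StrongWeakField

section Normalization

theorem norm_mul_norm_normalize_sub_normalize_le {E : Type*} [NormedAddCommGroup E]
    [NormedSpace ℝ E] (x y : E) : ‖y‖ * ‖normalize x - normalize y‖ ≤ 2 * ‖x - y‖ := by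
  have hone : ‖normalize x‖ ≤ 1 := by
    rcases eq_or_ne x 0 with rfl | hx
    · simp
    · exact (norm_normalize hx).le
  have hsplit : ‖y‖ • (normalize x - normalize y) = (x - y) + (‖y‖ - ‖x‖) • normalize x := by
    rw [smul_sub, sub_smul, norm_smul_normalize, norm_smul_normalize]
    abel
  calc ‖y‖ * ‖normalize x - normalize y‖
      = ‖(x - y) + (‖y‖ - ‖x‖) • normalize x‖ := by rw [← hsplit, norm_smul, norm_norm]
    _ ≤ ‖x - y‖ + |‖y‖ - ‖x‖| := by
      refine (norm_add_le _ _).trans (add_le_add_right ?_ _)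
      rw [norm_smul, Real.norm_eq_abs]
      exact mul_le_of_le_one_right (abs_nonneg _) hone
    _ ≤ 2 * ‖x - y‖ := by
      rw [two_mul, abs_sub_comm]
      gcongr
      exact abs_norm_sub_norm_le x y

theorem tendsto_normalize_sub_normalize {T E : Type*} [NormedAddCommGroup E] [NormedSpace ℝ E]
    {l : Filter T} {u v : T → E} (huv : u ~[l] v) :
    Tendsto (fun t => normalize (u t) - normalize (v t)) l (𝓝 0) := by
  refine Metric.tendsto_nhds.2 fun ε hε => ?_
  filter_upwards [huv.isLittleO.def (by positivity : 0 < ε / 4)] with t ht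
  rw [dist_zero_right]
  rcases eq_or_ne (v t) 0 with hv | hv
  · have hu : u t = 0 := by simpa [hv] using ht
    simpa [hu, hv] using hε
  · have hpos := norm_pos_iff.2 hv
    have hle := norm_mul_norm_normalize_sub_normalize_le (u t) (v t)
    rw [Pi.sub_apply] at ht
    nlinarith

theorem isEquivalent_norm {T E : Type*} [NormedAddCommGroup E] {l : Filter T} {u v : T → E}
    (huv : u ~[l] v) : (fun t => ‖u t‖) ~[l] fun t => ‖v t‖ :=
  (IsBigO.of_bound' (Eventually.of_forall fun t =>
    (abs_norm_sub_norm_le (u t) (v t)))).trans_isLittleO huv.isLittleO.norm_right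

variable {T Ω : Type*} [MeasurableSpace Ω] {P : Measure Ω} {l : Filter T}

theorem isEquivalent_toLp {X Y : T → Ω → ℝ} (hX : ∀ t, MemLp (X t) 2 P)
    (hY : ∀ t, MemLp (Y t) 2 P)
    (hXY : (fun t => ∫ ω, (X t ω - Y t ω) ^ 2 ∂P) =o[l] fun t => ∫ ω, Y t ω ^ 2 ∂P) :
    (fun t => (hX t).toLp (X t)) ~[l] fun t => (hY t).toLp (Y t) := by
  refine IsLittleO.of_norm_norm (IsLittleO.of_pow ?_ two_ne_zero)
  simp only [Pi.pow_def, Pi.sub_apply, ← MemLp.toLp_sub, norm_toLp_sq]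
  exact hXY

theorem norm_toLp_sq_eq_variance {X : Ω → ℝ} (hX : MemLp X 2 P) (hX0 : ∫ ω, X ω ∂P = 0) :
    ‖hX.toLp X‖ ^ 2 = variance X P := by
  rw [norm_toLp_sq, variance_of_integral_eq_zero hX.aestronglyMeasurable.aemeasurable hX0]

theorem isEquivalent_variance {X Y : T → Ω → ℝ} (hX : ∀ t, MemLp (X t) 2 P)
    (hY : ∀ t, MemLp (Y t) 2 P) (hX0 : ∀ t, ∫ ω, X t ω ∂P = 0) (hY0 : ∀ t, ∫ ω, Y t ω ∂P = 0)
    (hXY : (fun t => ∫ ω, (X t ω - Y t ω) ^ 2 ∂P) =o[l] fun t => ∫ ω, Y t ω ^ 2 ∂P) :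
    (fun t => variance (X t) P) ~[l] fun t => variance (Y t) P := by
  simpa only [Pi.pow_def, norm_toLp_sq_eq_variance, hX0, hY0] using
    (isEquivalent_norm (isEquivalent_toLp hX hY hXY)).pow 2

variable [IsProbabilityMeasure P] {ν : Measure ℝ} [IsProbabilityMeasure ν] {X Y : ℝ → Ω → ℝ}

theorem hasLimitLaw_of_isEquivalent_toLp (hX : ∀ r, MemLp (X r) 2 P)
    (hY : ∀ r, MemLp (Y r) 2 P) (hX0 : ∀ r, ∫ ω, X r ω ∂P = 0) (hY0 : ∀ r, ∫ ω, Y r ω ∂P = 0)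
    (hXY : (fun r => (hX r).toLp (X r)) ~[atTop] fun r => (hY r).toLp (Y r))
    (hν : HasLimitLaw P Y ν) : HasLimitLaw P X ν := by
  have hsqrt {Z : Ω → ℝ} (hZ : MemLp Z 2 P) (hZ0 : ∫ ω, Z ω ∂P = 0) :
      √(variance Z P) = ‖hZ.toLp Z‖ := by
    rw [← norm_toLp_sq_eq_variance hZ hZ0, Real.sqrt_sq (norm_nonneg _)]
  have hmeasure := tendstoInMeasure_of_tendsto_Lp (tendsto_normalize_sub_normalize hXY)
  refine tendstoInDistribution_of_tendstoInMeasure_sub _ _ hν (hmeasure.congr (fun r => ?_) ?_)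
    fun r => (hX r).aestronglyMeasurable.aemeasurable.div_const _
  · change _ =ᵐ[P] fun ω => X r ω / √(variance (X r) P) - Y r ω / √(variance (Y r) P)
    rw [hsqrt (hX r) (hX0 r), hsqrt (hY r) (hY0 r), NormedSpace.normalize, NormedSpace.normalize,
      ← MemLp.toLp_const_smul, ← MemLp.toLp_const_smul, ← MemLp.toLp_sub]
    refine (MemLp.coeFn_toLp _).trans (Eventually.of_forall fun ω => ?_)
    simp [div_eq_inv_mul]
  · exact Lp.coeFn_zero _ _ _

theorem hasLimitLaw_iff (hX : ∀ r, MemLp (X r) 2 P) (hY : ∀ r, MemLp (Y r) 2 P)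
    (hX0 : ∀ r, ∫ ω, X r ω ∂P = 0) (hY0 : ∀ r, ∫ ω, Y r ω ∂P = 0)
    (hXY : (fun r => ∫ ω, (X r ω - Y r ω) ^ 2 ∂P) =o[atTop] fun r => ∫ ω, Y r ω ^ 2 ∂P) :
    HasLimitLaw P X ν ↔ HasLimitLaw P Y ν :=
  have hequiv := isEquivalent_toLp hX hY hXY
  ⟨hasLimitLaw_of_isEquivalent_toLp hY hX hY0 hX0 hequiv.symm,
    hasLimitLaw_of_isEquivalent_toLp hX hY hX0 hY0 hequiv⟩

theorem hasLimitLaw_congr (hXY : ∀ r, X r =ᵐ[P] Y r) : HasLimitLaw P X ν ↔ HasLimitLaw P Y ν := by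
  have hdiv (r : ℝ) : (fun ω => X r ω / √(variance (X r) P)) =ᵐ[P]
      fun ω => Y r ω / √(variance (Y r) P) := by
    filter_upwards [hXY r] with ω hω
    rw [hω, variance_congr (hXY r)]
  exact ⟨fun hX => hX.congr hdiv (ae_eq_refl _),
    fun hY => hY.congr (fun r => (hdiv r).symm) (ae_eq_refl _)⟩

end Normalization

section Energy

variable {E : Type*} [NormedAddCommGroup E] {f g : E → ℝ} {C R : ℝ}

theorem exists_norm_le_add_indicator_ball (hf0 : ∀ x, 0 ≤ f x) (hgC : ∀ x, ‖g x‖ ≤ C)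
    (hgf : g =o[Bornology.cobounded E] f) {ε : ℝ} (hε : 0 < ε) :
    ∃ R, ∀ x, ‖g x‖ ≤ ε * f x + C * (Metric.ball 0 R).indicator 1 x := by
  obtain ⟨R, -, hR⟩ := hasBasis_cobounded_norm.eventually_iff.1 (hgf.def hε)
  refine ⟨R, fun x => ?_⟩
  by_cases hx : x ∈ Metric.ball (0 : E) R
  · rw [Set.indicator_of_mem hx, Pi.one_apply, mul_one]
    exact (hgC x).trans (le_add_of_nonneg_left (mul_nonneg hε.le (hf0 x)))
  · rw [Set.indicator_of_notMem hx, mul_zero, add_zero, ← Real.norm_of_nonneg (hf0 x)]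
    exact hR (by simpa using hx)

variable [MeasurableSpace E] {μ : Measure E}

/-- The energy `∬ f (x - y) dμ(x) dμ(y)` of a measure for a translation-invariant interaction `f`.
With `f` a covariance function and `μ` the Lebesgue measure on the window, it is the variance of
the integral of a stationary field. -/
noncomputable def energy (f : E → ℝ) (μ : Measure E) : ℝ :=
  ∫ z, f (z.1 - z.2) ∂(μ.prod μ)

theorem energy_nonneg (hf : ∀ x, 0 ≤ f x) : 0 ≤ energy f μ :=
  integral_nonneg fun _ => hf _

variable [BorelSpace E] [SecondCountableTopology E] {A : Set E}

theorem integrable_sub_of_bounded [IsFiniteMeasure μ] (hf : Measurable f)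
    (hC : ∀ x, ‖f x‖ ≤ C) : Integrable (fun z : E × E => f (z.1 - z.2)) (μ.prod μ) :=
  .of_bound (hf.comp (measurable_fst.sub measurable_snd)).aestronglyMeasurable C
    (.of_forall fun _ => hC _)

theorem energy_mono [IsFiniteMeasure μ] {C' : ℝ} (hf : Measurable f) (hfC : ∀ x, ‖f x‖ ≤ C)
    (hg : Measurable g) (hgC : ∀ x, ‖g x‖ ≤ C') (hfg : ∀ x, f x ≤ g x) :
    energy f μ ≤ energy g μ :=
  integral_mono (integrable_sub_of_bounded hf hfC) (integrable_sub_of_bounded hg hgC)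
    fun _ => hfg _

theorem energy_pos [IsFiniteMeasure μ] [NeZero μ] (hf : Measurable f) (hf0 : ∀ x, 0 < f x)
    (hfC : ∀ x, ‖f x‖ ≤ C) : 0 < energy f μ := by
  refine (integral_pos_iff_support_of_nonneg (fun z => (hf0 _).le)
    (integrable_sub_of_bounded hf hfC)).2 ?_
  rw [Function.support_eq_univ fun z => (hf0 _).ne', ← Set.univ_prod_univ, Measure.prod_prod]
  exact ENNReal.mul_pos (NeZero.ne _) (NeZero.ne _)

theorem integrable_indicator_ball_sub [IsFiniteMeasure μ] (R : ℝ) :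
    Integrable (fun z : E × E => (Metric.ball (0 : E) R).indicator (1 : E → ℝ) (z.1 - z.2))
      (μ.prod μ) :=
  integrable_sub_of_bounded (measurable_one.indicator Metric.isOpen_ball.measurableSet)
    fun _ => (norm_indicator_le_norm_self _ _).trans_eq norm_one

theorem energy_indicator_ball_le [μ.IsAddHaarMeasure] [ProperSpace E]
    [IsFiniteMeasure (μ.restrict A)] :
    energy ((Metric.ball 0 R).indicator 1) (μ.restrict A) ≤
      μ.real A * μ.real (Metric.ball 0 R) := by
  have hint := integrable_indicator_ball_sub (μ := μ.restrict A) R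
  have hinner (y : E) : ∫ x, (Metric.ball (0 : E) R).indicator (1 : E → ℝ) (x - y)
      ∂(μ.restrict A) ≤ μ.real (Metric.ball 0 R) := by
    have hball : (fun x => (Metric.ball (0 : E) R).indicator (1 : E → ℝ) (x - y)) =
        (Metric.ball y R).indicator 1 := by
      classical
      ext x
      simp [Set.indicator_apply, dist_eq_norm]
    rw [hball, integral_indicator_one Metric.isOpen_ball.measurableSet,
      measureReal_def, measureReal_def, ← Measure.addHaar_ball_center μ y]
    exact ENNReal.toReal_mono measure_ball_lt_top.ne (Measure.restrict_apply_le _ _)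
  calc energy ((Metric.ball 0 R).indicator 1) (μ.restrict A)
      = ∫ y, ∫ x, (Metric.ball (0 : E) R).indicator (1 : E → ℝ) (x - y)
          ∂(μ.restrict A) ∂(μ.restrict A) := integral_prod_symm _ hint
    _ ≤ ∫ _, μ.real (Metric.ball 0 R) ∂(μ.restrict A) :=
        integral_mono hint.integral_prod_right (integrable_const _) hinner
    _ = μ.real A * μ.real (Metric.ball 0 R) := by
        rw [integral_const, measureReal_restrict_apply_univ, smul_eq_mul]

theorem mul_sub_le_energy [μ.IsAddHaarMeasure] [ProperSpace E]
    (hA : IsCompact A) (hf : Measurable f) (hf0 : ∀ x, 0 ≤ f x) (hfC : ∀ x, ‖f x‖ ≤ C)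
    {a : ℝ} (ha : 0 ≤ a) (hfa : ∀ x ∈ A, ∀ y ∈ A, R ≤ ‖x - y‖ → a ≤ f (x - y)) :
    a * (μ.real A ^ 2 - μ.real A * μ.real (Metric.ball 0 R)) ≤ energy f (μ.restrict A) := by
  have : IsFiniteMeasure (μ.restrict A) := isFiniteMeasure_restrict.2 hA.measure_lt_top.ne
  have hint := integrable_indicator_ball_sub (μ := μ.restrict A) R
  have hpt : ∀ᵐ z ∂((μ.restrict A).prod (μ.restrict A)),
      a * (1 - (Metric.ball (0 : E) R).indicator (1 : E → ℝ) (z.1 - z.2)) ≤ f (z.1 - z.2) := by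
    rw [Measure.prod_restrict]
    filter_upwards [ae_restrict_mem (hA.measurableSet.prod hA.measurableSet)] with z hz
    by_cases hzR : z.1 - z.2 ∈ Metric.ball (0 : E) R
    · simpa [Set.indicator_of_mem hzR] using hf0 _
    · simpa [Set.indicator_of_notMem hzR] using hfa _ hz.1 _ hz.2 (by simpa using hzR)
  calc a * (μ.real A ^ 2 - μ.real A * μ.real (Metric.ball 0 R))
      ≤ a * (μ.real A ^ 2 - energy ((Metric.ball 0 R).indicator 1) (μ.restrict A)) := by
        gcongr
        exact energy_indicator_ball_le
    _ = ∫ z, a * (1 - (Metric.ball (0 : E) R).indicator (1 : E → ℝ) (z.1 - z.2))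
          ∂((μ.restrict A).prod (μ.restrict A)) := by
        rw [integral_const_mul, integral_sub (integrable_const 1) hint, integral_const,
          smul_eq_mul, mul_one, ← Set.univ_prod_univ, measureReal_prod_prod, ← pow_two,
          measureReal_restrict_apply_univ, energy]
    _ ≤ energy f (μ.restrict A) :=
        integral_mono_ae (((integrable_const 1).sub hint).const_mul _)
          (integrable_sub_of_bounded hf hfC) hpt

end Energy

section Windows

variable {E : Type*} [NormedAddCommGroup E] [NormedSpace ℝ E]

theorem exists_norm_sub_le_of_mem_smul {Δ : Set E} (hΔ : IsCompact Δ) :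
    ∃ D > 0, ∀ r > 0, ∀ x ∈ r • Δ, ∀ y ∈ r • Δ, ‖x - y‖ ≤ D * r := by
  obtain ⟨D, hD⟩ := Metric.isBounded_iff.1 hΔ.isBounded
  refine ⟨max D 1, by positivity, fun r hr => ?_⟩
  rintro _ ⟨x, hx, rfl⟩ _ ⟨y, hy, rfl⟩
  rw [← dist_eq_norm, dist_smul₀, Real.norm_of_nonneg hr.le, mul_comm]
  gcongr
  exact (hD hx hy).trans (le_max_left _ _)

variable [FiniteDimensional ℝ E] [MeasurableSpace E] [BorelSpace E] {μ : Measure E}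
  [μ.IsAddHaarMeasure] {f g : E → ℝ} {C C' s : ℝ} {Δ : Set E}

open Module Bornology

theorem measureReal_smul_of_pos (Δ : Set E) {r : ℝ} (hr : 0 < r) :
    μ.real (r • Δ) = r ^ finrank ℝ E * μ.real Δ := by
  rw [measureReal_def, Measure.addHaar_smul, ENNReal.toReal_mul,
    ENNReal.toReal_ofReal (abs_nonneg _), abs_of_pos (by positivity), measureReal_def]

theorem isLittleO_rpow_rpow_of_lt {a b : ℝ} (hab : a < b) :
    (fun r : ℝ => r ^ a) =o[atTop] fun r => r ^ b := by
  refine (isLittleO_iff_tendsto' ?_).2 ?_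
  · filter_upwards [eventually_gt_atTop 0] with r hr h
    exact absurd h (Real.rpow_pos_of_pos hr b).ne'
  · refine (tendsto_rpow_neg_atTop (sub_pos.2 hab)).congr' ?_
    filter_upwards [eventually_gt_atTop 0] with r hr
    rw [← Real.rpow_sub hr, neg_sub]

theorem rpow_isBigO_energy (hΔ : IsCompact Δ) (hvol : 0 < μ Δ) (hf : Measurable f)
    (hf0 : ∀ x, 0 ≤ f x) (hfC : ∀ x, ‖f x‖ ≤ C) (hs : 0 ≤ s) (hd : 0 < finrank ℝ E)
    (hfs : ∀ᶠ x in cobounded E, ‖x‖ ^ (-s) ≤ f x) :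
    (fun r : ℝ => r ^ (2 * finrank ℝ E - s)) =O[atTop] fun r => energy f (μ.restrict (r • Δ)) := by
  have hv : 0 < μ.real Δ := ENNReal.toReal_pos hvol.ne' hΔ.measure_lt_top.ne
  obtain ⟨D, hD, hdist⟩ := exists_norm_sub_le_of_mem_smul hΔ
  obtain ⟨R, -, hR⟩ :=
    hasBasis_cobounded_norm.eventually_iff.1 (hfs.and (eventually_ne_cobounded 0))
  have hlarge : ∀ᶠ r : ℝ in atTop, 2 * μ.real (Metric.ball 0 R) ≤ r ^ finrank ℝ E * μ.real Δ :=
    ((tendsto_pow_atTop hd.ne').atTop_mul_const hv).eventually_ge_atTop _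
  refine .of_bound (2 * (D ^ s / μ.real Δ ^ 2)) ?_
  filter_upwards [eventually_gt_atTop 0, hlarge] with r hr hBV
  have hlower : (D * r) ^ (-s) * ((r ^ finrank ℝ E * μ.real Δ) ^ 2 -
      r ^ finrank ℝ E * μ.real Δ * μ.real (Metric.ball 0 R)) ≤ energy f (μ.restrict (r • Δ)) := by
    rw [← measureReal_smul_of_pos Δ hr]
    refine mul_sub_le_energy (hΔ.smul r) hf hf0 hfC (by positivity) fun x hx y hy hxy => ?_
    obtain ⟨hle, hne⟩ := hR hxy
    exact (Real.rpow_le_rpow_of_nonpos (norm_pos_iff.2 hne) (hdist r hr x hx y hy)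
      (by linarith)).trans hle
  have hexp : r ^ (2 * finrank ℝ E - s) = (r ^ finrank ℝ E) ^ 2 * r ^ (-s) := by
    rw [sub_eq_add_neg, Real.rpow_add hr, ← pow_mul, mul_comm _ 2, ← Real.rpow_natCast]
    norm_cast
  rw [Real.norm_of_nonneg (by positivity)]
  refine le_trans ?_ (mul_le_mul_of_nonneg_left (hlower.trans (Real.le_norm_self _))
    (by positivity))
  calc r ^ (2 * finrank ℝ E - s)
      = 2 * (D ^ s / μ.real Δ ^ 2) *
          ((D * r) ^ (-s) * ((r ^ finrank ℝ E * μ.real Δ) ^ 2 / 2)) := by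
        rw [hexp, Real.mul_rpow hD.le hr.le, Real.rpow_neg hD.le]
        have := Real.rpow_pos_of_pos hD s
        field_simp
    _ ≤ _ := by
        gcongr
        have := mul_le_mul_of_nonneg_left hBV
          (show 0 ≤ r ^ finrank ℝ E * μ.real Δ by positivity)
        linarith

theorem energy_le_of_norm_le [IsFiniteMeasure (μ.restrict Δ)] {ε R : ℝ} (hf : Measurable f)
    (hfC : ∀ x, ‖f x‖ ≤ C) (hC' : 0 ≤ C')
    (hg : ∀ x, ‖g x‖ ≤ ε * f x + C' * (Metric.ball 0 R).indicator 1 x) :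
    ‖energy g (μ.restrict Δ)‖ ≤
      ε * energy f (μ.restrict Δ) + C' * (μ.real Δ * μ.real (Metric.ball 0 R)) := by
  have hfint := (integrable_sub_of_bounded (μ := μ.restrict Δ) hf hfC).const_mul ε
  have hint := (integrable_indicator_ball_sub (μ := μ.restrict Δ) R).const_mul C'
  calc ‖energy g (μ.restrict Δ)‖
      ≤ ∫ z, (ε * f (z.1 - z.2) + C' * (Metric.ball (0 : E) R).indicator (1 : E → ℝ) (z.1 - z.2))
          ∂((μ.restrict Δ).prod (μ.restrict Δ)) :=
        norm_integral_le_of_norm_le (hfint.add hint) (.of_forall fun z => hg _)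
    _ = ε * energy f (μ.restrict Δ) +
          C' * energy ((Metric.ball 0 R).indicator 1) (μ.restrict Δ) := by
        rw [integral_add hfint hint, integral_const_mul, integral_const_mul, energy, energy]
    _ ≤ _ := by
        gcongr
        exact energy_indicator_ball_le

-- At scale `r` the pairs of points at bounded distance have mass `O(r ^ d)`, negligible against
-- the energy of `f`, which is at least of order `r ^ (2 * d - s)`.
theorem energy_isLittleO (hΔ : IsCompact Δ) (hvol : 0 < μ Δ) (hf : Measurable f)
    (hf0 : ∀ x, 0 ≤ f x) (hfC : ∀ x, ‖f x‖ ≤ C) (hs : 0 ≤ s) (hsd : s < finrank ℝ E)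
    (hfs : ∀ᶠ x in cobounded E, ‖x‖ ^ (-s) ≤ f x) (hgC : ∀ x, ‖g x‖ ≤ C')
    (hgf : g =o[cobounded E] f) :
    (fun r : ℝ => energy g (μ.restrict (r • Δ))) =o[atTop]
      fun r => energy f (μ.restrict (r • Δ)) := by
  have hsmall : (fun r : ℝ => μ.real (r • Δ)) =o[atTop]
      fun r => energy f (μ.restrict (r • Δ)) := by
    refine IsLittleO.trans_isBigO ?_ (rpow_isBigO_energy hΔ hvol hf hf0 hfC hs
      (Nat.cast_pos.1 (hs.trans_lt hsd)) hfs)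
    refine ((isLittleO_rpow_rpow_of_lt (a := finrank ℝ E) (by linarith)).const_mul_left
      (μ.real Δ)).congr' ?_ .rfl
    filter_upwards [eventually_gt_atTop 0] with r hr
    rw [measureReal_smul_of_pos Δ hr, Real.rpow_natCast, mul_comm]
  refine isLittleO_iff.2 fun ε hε => ?_
  obtain ⟨R, hR⟩ := exists_norm_le_add_indicator_ball hf0 hgC hgf (half_pos hε)
  filter_upwards [(hsmall.const_mul_left (C' * μ.real (Metric.ball (0 : E) R))).def (half_pos hε)]
    with r hr
  have : IsFiniteMeasure (μ.restrict (r • Δ)) :=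
    isFiniteMeasure_restrict.2 (hΔ.smul r).measure_lt_top.ne
  have hle := energy_le_of_norm_le (μ := μ) (Δ := r • Δ) hf hfC ((norm_nonneg _).trans (hgC 0)) hR
  have hself := mul_le_mul_of_nonneg_left (Real.le_norm_self (energy f (μ.restrict (r • Δ))))
    (half_pos hε).le
  linarith [(Real.le_norm_self _).trans hr]

end Windows

section Correlation

variable {E : Type*} [NormedAddCommGroup E] {α β s : ℝ} {L L₁ L₂ : ℝ → ℝ}

open Bornology

/-- The correlation function `‖x‖ ^ (-α) * L ‖x‖`, with value `1` at the origin. -/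
noncomputable def corr (α : ℝ) (L : ℝ → ℝ) (x : E) : ℝ :=
  open Classical in if x = 0 then 1 else ‖x‖ ^ (-α) * L ‖x‖

namespace SlowlyVarying

theorem corr_pos (hL : SlowlyVarying L) (x : E) : 0 < corr α L x := by
  unfold corr
  split_ifs with hx
  · exact one_pos
  · have := norm_pos_iff.2 hx
    exact mul_pos (Real.rpow_pos_of_pos this _) (hL.pos _ this)

theorem measurable_corr [MeasurableSpace E] [BorelSpace E] (hL : SlowlyVarying L) :
    Measurable (corr α L : E → ℝ) := by
  refine measurable_of_measurable_on_compl_singleton 0 ?_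
  have hnorm : Measurable fun x : {x : E | x ≠ 0} => ‖(x : E)‖ :=
    measurable_norm.comp measurable_subtype_coe
  have hpos : Measurable fun x : {x : E | x ≠ 0} =>
      (⟨‖(x : E)‖, norm_pos_iff.2 x.2⟩ : Set.Ioi (0 : ℝ)) := hnorm.subtype_mk
  convert (hnorm.pow_const (-α)).mul (hL.measurable.comp hpos) using 1
  ext x
  exact if_neg x.2

theorem eventually_rpow_neg_le_corr (hL : SlowlyVarying L) (hs : α < s) :
    ∀ᶠ x in cobounded E, ‖x‖ ^ (-s) ≤ corr α L x := by
  have hL' := hL.eventually_rpow_neg_le_and_le_rpow (sub_pos.2 hs)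
  filter_upwards [tendsto_norm_cobounded_atTop.eventually hL', eventually_ne_cobounded 0]
    with x hx hx0
  rw [corr, if_neg hx0, show -s = -α + -(s - α) by ring, Real.rpow_add (norm_pos_iff.2 hx0)]
  gcongr
  exact hx.1

theorem eventually_corr_le_rpow_neg (hL : SlowlyVarying L) (hs : s < α) :
    ∀ᶠ x in cobounded E, corr α L x ≤ ‖x‖ ^ (-s) := by
  have hL' := hL.eventually_rpow_neg_le_and_le_rpow (sub_pos.2 hs)
  filter_upwards [tendsto_norm_cobounded_atTop.eventually hL', eventually_ne_cobounded 0]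
    with x hx hx0
  rw [corr, if_neg hx0, show -s = -α + (α - s) by ring, Real.rpow_add (norm_pos_iff.2 hx0)]
  gcongr
  exact hx.2

theorem eventually_rpow_neg_le_corr_pow (hL : SlowlyVarying L) {k : ℕ} (hk : 0 < k)
    (hs : α * k < s) : ∀ᶠ x in cobounded E, ‖x‖ ^ (-s) ≤ corr α L x ^ k := by
  have hk' : (0 : ℝ) < k := Nat.cast_pos.2 hk
  filter_upwards [hL.eventually_rpow_neg_le_corr ((lt_div_iff₀ hk').2 hs)] with x hx
  calc ‖x‖ ^ (-s) = (‖x‖ ^ (-(s / k))) ^ k := by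
        rw [← Real.rpow_natCast, ← Real.rpow_mul (norm_nonneg x), neg_mul,
          div_mul_cancel₀ _ hk'.ne']
    _ ≤ corr α L x ^ k := by gcongr

theorem tendsto_corr (hL : SlowlyVarying L) (hα : 0 < α) :
    Tendsto (corr α L) (cobounded E) (𝓝 0) :=
  squeeze_zero' (.of_forall fun x => (hL.corr_pos x).le)
    (hL.eventually_corr_le_rpow_neg (half_lt_self hα))
    ((tendsto_rpow_neg_atTop (half_pos hα)).comp tendsto_norm_cobounded_atTop)

theorem corr_isLittleO_corr_pow (hL₁ : SlowlyVarying L₁) (hL₂ : SlowlyVarying L₂) {k : ℕ}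
    (hk : 0 < k) (hαβ : α * k < β) :
    (corr β L₁ : E → ℝ) =o[cobounded E] fun x => corr α L₂ x ^ k := by
  obtain ⟨s, hs, hsβ⟩ := exists_between hαβ
  obtain ⟨t, hst, htβ⟩ := exists_between hsβ
  have hupper : (corr β L₁ : E → ℝ) =O[cobounded E] fun x => ‖x‖ ^ (-t) :=
    .of_norm_eventuallyLE <| by
      filter_upwards [hL₁.eventually_corr_le_rpow_neg htβ] with x hx
      rwa [Real.norm_of_nonneg (hL₁.corr_pos x).le]
  have hlower : (fun x : E => ‖x‖ ^ (-s)) =O[cobounded E] fun x => corr α L₂ x ^ k :=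
    .of_norm_eventuallyLE <| by
      filter_upwards [hL₂.eventually_rpow_neg_le_corr_pow hk hs] with x hx
      rwa [Real.norm_of_nonneg (by positivity)]
  exact hupper.trans_isLittleO (((isLittleO_rpow_rpow_of_lt (neg_lt_neg hst)).comp_tendsto
    tendsto_norm_cobounded_atTop).trans_isBigO hlower)

end SlowlyVarying

/-- The majorant of the covariances of the Hermite components that do not contribute to the limit.
The truncation at `1` matters only for `m = 0`, when nothing bounds `corr β L₁` near the origin. -/
noncomputable def majorant (α β : ℝ) (L₁ L₂ : ℝ → ℝ) (κ : ℕ) (x : E) : ℝ :=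
  min 1 (corr β L₁ x + corr α L₂ x ^ (κ + 1))

variable {κ : ℕ}

theorem majorant_nonneg (hL₁ : SlowlyVarying L₁) (hL₂ : SlowlyVarying L₂) (x : E) :
    0 ≤ majorant α β L₁ L₂ κ x :=
  le_min zero_le_one (add_nonneg (hL₁.corr_pos x).le (pow_nonneg (hL₂.corr_pos x).le _))

theorem norm_majorant_le_one (hL₁ : SlowlyVarying L₁) (hL₂ : SlowlyVarying L₂) (x : E) :
    ‖majorant α β L₁ L₂ κ x‖ ≤ 1 := by
  rw [Real.norm_of_nonneg (majorant_nonneg hL₁ hL₂ x)]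
  exact min_le_left _ _

theorem measurable_majorant [MeasurableSpace E] [BorelSpace E] (hL₁ : SlowlyVarying L₁)
    (hL₂ : SlowlyVarying L₂) : Measurable (majorant α β L₁ L₂ κ : E → ℝ) :=
  measurable_const.min (hL₁.measurable_corr.add (hL₂.measurable_corr.pow_const _))

theorem majorant_isLittleO (hL₁ : SlowlyVarying L₁) (hL₂ : SlowlyVarying L₂) (hκ : 0 < κ)
    (hα : 0 < α) (hαβ : α * κ < β) :
    (majorant α β L₁ L₂ κ : E → ℝ) =o[cobounded E] fun x => corr α L₂ x ^ κ := by
  have hpow : (fun x : E => corr α L₂ x ^ (κ + 1)) =o[cobounded E] fun x => corr α L₂ x ^ κ := by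
    simpa only [pow_succ', one_mul] using
      ((isLittleO_one_iff ℝ).2 (hL₂.tendsto_corr hα)).mul_isBigO (isBigO_refl _ _)
  refine (IsBigO.of_norm_le fun x => ?_).trans_isLittleO
    ((hL₁.corr_isLittleO_corr_pow hL₂ hκ hαβ).add hpow)
  rw [Real.norm_of_nonneg (majorant_nonneg hL₁ hL₂ x)]
  exact min_le_right _ _

end Correlation

section CovarianceBounds

variable {d m n : ℕ} {Ω : Type*} [MeasurableSpace Ω] {P : Measure Ω}
  {α β : ℝ} {L₁ L₂ : ℝ → ℝ} {η : EuclideanSpace ℝ (Fin d) → Ω → (Fin m ⊕ Fin n → ℝ)}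
  {κ : ℕ} {v : Fin m ⊕ Fin n → ℕ} {F H : (Fin m ⊕ Fin n → ℝ) → ℝ}

theorem covMatrix_inl (x : EuclideanSpace ℝ (Fin d)) (j : Fin m) :
    covMatrix m n α β L₁ L₂ x (Sum.inl j) (Sum.inl j) = corr β L₁ x := by
  unfold covMatrix corr
  split_ifs <;> simp

theorem covMatrix_inr (x : EuclideanSpace ℝ (Fin d)) (j : Fin n) :
    covMatrix m n α β L₁ L₂ x (Sum.inr j) (Sum.inr j) = corr α L₂ x := by
  unfold covMatrix corr
  split_ifs <;> simp

theorem covProd_eq_corr_pow_mul_corr_pow (v : Fin m ⊕ Fin n → ℕ)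
    (x : EuclideanSpace ℝ (Fin d)) : covProd α β L₁ L₂ v x =
      corr β L₁ x ^ (∑ j, v (Sum.inl j)) * corr α L₂ x ^ (∑ j, v (Sum.inr j)) := by
  simp only [covProd, Fintype.prod_sum_type, covMatrix_inl, covMatrix_inr,
    Finset.prod_pow_eq_pow_sum]

theorem measurable_covProd (hL₁ : SlowlyVarying L₁) (hL₂ : SlowlyVarying L₂)
    (v : Fin m ⊕ Fin n → ℕ) :
    Measurable (covProd α β L₁ L₂ v : EuclideanSpace ℝ (Fin d) → ℝ) := by
  simp only [funext (covProd_eq_corr_pow_mul_corr_pow v)]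
  exact (hL₁.measurable_corr.pow_const _).mul (hL₂.measurable_corr.pow_const _)

theorem covProd_pos (hL₁ : SlowlyVarying L₁) (hL₂ : SlowlyVarying L₂)
    (v : Fin m ⊕ Fin n → ℕ) (x : EuclideanSpace ℝ (Fin d)) : 0 < covProd α β L₁ L₂ v x := by
  rw [covProd_eq_corr_pow_mul_corr_pow]
  exact mul_pos (pow_pos (hL₁.corr_pos x) _) (pow_pos (hL₂.corr_pos x) _)

/-- The multi-indices whose Hermite components do not contribute to the limit, for a functional
of Hermite rank `κ`. -/
def IsNegligible (κ : ℕ) (v : Fin m ⊕ Fin n → ℕ) : Prop :=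
  ∑ j, v (Sum.inl j) ≠ 0 ∨ κ < ∑ j, v (Sum.inr j)

namespace IsStrongWeakField

variable [IsProbabilityMeasure P]

theorem corr_le_one_inl (hη : IsStrongWeakField P α β L₁ L₂ η)
    (hv : ∑ j, v (Sum.inl j) ≠ 0) (x : EuclideanSpace ℝ (Fin d)) : corr β L₁ x ≤ 1 := by
  obtain ⟨j, -, -⟩ := Finset.exists_ne_zero_of_sum_ne_zero hv
  exact covMatrix_inl x j ▸ hη.covMatrix_le_one x (Sum.inl j)

theorem corr_le_one_inr (hη : IsStrongWeakField P α β L₁ L₂ η)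
    (hv : ∑ j, v (Sum.inr j) ≠ 0) (x : EuclideanSpace ℝ (Fin d)) : corr α L₂ x ≤ 1 := by
  obtain ⟨j, -, -⟩ := Finset.exists_ne_zero_of_sum_ne_zero hv
  exact covMatrix_inr x j ▸ hη.covMatrix_le_one x (Sum.inr j)

theorem corr_pow_sum_inl_le_one (hη : IsStrongWeakField P α β L₁ L₂ η) (hL₁ : SlowlyVarying L₁)
    (v : Fin m ⊕ Fin n → ℕ) (x : EuclideanSpace ℝ (Fin d)) :
    corr β L₁ x ^ (∑ j, v (Sum.inl j)) ≤ 1 := by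
  by_cases hv : ∑ j, v (Sum.inl j) = 0
  · rw [hv, pow_zero]
  · exact pow_le_one₀ (hL₁.corr_pos x).le (hη.corr_le_one_inl hv x)

theorem corr_pow_sum_inr_le_one (hη : IsStrongWeakField P α β L₁ L₂ η) (hL₂ : SlowlyVarying L₂)
    (v : Fin m ⊕ Fin n → ℕ) (x : EuclideanSpace ℝ (Fin d)) :
    corr α L₂ x ^ (∑ j, v (Sum.inr j)) ≤ 1 := by
  by_cases hv : ∑ j, v (Sum.inr j) = 0
  · rw [hv, pow_zero]
  · exact pow_le_one₀ (hL₂.corr_pos x).le (hη.corr_le_one_inr hv x)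

theorem norm_covProd_le_one (hη : IsStrongWeakField P α β L₁ L₂ η) (hL₁ : SlowlyVarying L₁)
    (hL₂ : SlowlyVarying L₂) (v : Fin m ⊕ Fin n → ℕ) (x : EuclideanSpace ℝ (Fin d)) :
    ‖covProd α β L₁ L₂ v x‖ ≤ 1 := by
  rw [Real.norm_of_nonneg (covProd_pos hL₁ hL₂ v x).le, covProd_eq_corr_pow_mul_corr_pow]
  exact mul_le_one₀ (hη.corr_pow_sum_inl_le_one hL₁ v x) (pow_nonneg (hL₂.corr_pos x).le _)
    (hη.corr_pow_sum_inr_le_one hL₂ v x)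

theorem covProd_le_majorant (hη : IsStrongWeakField P α β L₁ L₂ η) (hL₁ : SlowlyVarying L₁)
    (hL₂ : SlowlyVarying L₂) (hv : IsNegligible κ v) (x : EuclideanSpace ℝ (Fin d)) :
    covProd α β L₁ L₂ v x ≤ majorant α β L₁ L₂ κ x := by
  refine le_min ((Real.le_norm_self _).trans (hη.norm_covProd_le_one hL₁ hL₂ v x)) ?_
  have hpos₁ := (hL₁.corr_pos (α := β) x).le
  have hpos₂ := (hL₂.corr_pos (α := α) x).le
  rw [covProd_eq_corr_pow_mul_corr_pow]
  rcases hv with hv | hv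
  · exact (mul_le_of_le_one_right (pow_nonneg hpos₁ _) (hη.corr_pow_sum_inr_le_one hL₂ v x)).trans
      ((pow_le_of_le_one hpos₁ (hη.corr_le_one_inl hv x) hv).trans
        (le_add_of_nonneg_right (pow_nonneg hpos₂ _)))
  · exact (mul_le_of_le_one_left (pow_nonneg hpos₂ _) (hη.corr_pow_sum_inl_le_one hL₁ v x)).trans
      ((pow_le_pow_of_le_one hpos₂ (hη.corr_le_one_inr (Nat.ne_zero_of_lt hv) x) hv).trans
        (le_add_of_nonneg_left hpos₁))

variable {μ : Measure (EuclideanSpace ℝ (Fin d))} [IsFiniteMeasure μ]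

theorem hasSum_integral_fieldIntegral_sq (hη : IsStrongWeakField P α β L₁ L₂ η)
    (hF : MemLp F 2 (stdGauss (Fin m ⊕ Fin n))) :
    HasSum (fun v => hermiteCoeff F v ^ 2 / (multiFactorial v : ℝ) * energy (covProd α β L₁ L₂ v) μ)
      (∫ ω, fieldIntegral η μ F ω ^ 2 ∂P) :=
  hη.hasMarginalLaw.hasSum_integral_fieldIntegral_sq
    (c := fun v z => covProd α β L₁ L₂ v (z.1 - z.2)) hη.integral_hermiteProd_mul_hermiteProd hF

theorem integral_fieldIntegral_sq_le_energy_majorant (hη : IsStrongWeakField P α β L₁ L₂ η)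
    (hL₁ : SlowlyVarying L₁) (hL₂ : SlowlyVarying L₂)
    (hF : MemLp F 2 (stdGauss (Fin m ⊕ Fin n)))
    (hneg : ∀ v, hermiteCoeff F v ≠ 0 → IsNegligible κ v) :
    ∫ ω, fieldIntegral η μ F ω ^ 2 ∂P ≤
      (∫ w, F w ^ 2 ∂(stdGauss (Fin m ⊕ Fin n))) * energy (majorant α β L₁ L₂ κ) μ := by
  refine hasSum_le (fun v => ?_) (hη.hasSum_integral_fieldIntegral_sq hF)
    ((hasSum_hermiteCoeff_sq_div hF).mul_right _)
  by_cases hv : hermiteCoeff F v = 0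
  · simp [hv]
  · refine mul_le_mul_of_nonneg_left ?_ (div_nonneg (sq_nonneg _) (multiFactorial_pos v).le)
    exact energy_mono (measurable_covProd hL₁ hL₂ v) (hη.norm_covProd_le_one hL₁ hL₂ v)
      (measurable_majorant hL₁ hL₂) (norm_majorant_le_one hL₁ hL₂)
      (hη.covProd_le_majorant hL₁ hL₂ (hneg v hv))

theorem mul_energy_covProd_le_integral_fieldIntegral_sq (hη : IsStrongWeakField P α β L₁ L₂ η)
    (hL₁ : SlowlyVarying L₁) (hL₂ : SlowlyVarying L₂)
    (hF : MemLp F 2 (stdGauss (Fin m ⊕ Fin n))) (v : Fin m ⊕ Fin n → ℕ) :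
    hermiteCoeff F v ^ 2 / (multiFactorial v : ℝ) * energy (covProd α β L₁ L₂ v) μ ≤
      ∫ ω, fieldIntegral η μ F ω ^ 2 ∂P :=
  le_hasSum (hη.hasSum_integral_fieldIntegral_sq hF) v fun u _ =>
    mul_nonneg (div_nonneg (sq_nonneg _) (multiFactorial_pos u).le)
      (energy_nonneg fun x => (covProd_pos hL₁ hL₂ u x).le)

theorem integral_fieldIntegral_sq_pos (hη : IsStrongWeakField P α β L₁ L₂ η)
    (hL₁ : SlowlyVarying L₁) (hL₂ : SlowlyVarying L₂) [NeZero μ]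
    (hF : MemLp F 2 (stdGauss (Fin m ⊕ Fin n))) (hv : hermiteCoeff F v ≠ 0) :
    0 < ∫ ω, fieldIntegral η μ F ω ^ 2 ∂P :=
  (mul_pos (div_pos (by positivity) (multiFactorial_pos v))
    (energy_pos (measurable_covProd hL₁ hL₂ v) (covProd_pos hL₁ hL₂ v)
      (hη.norm_covProd_le_one hL₁ hL₂ v))).trans_le
    (hη.mul_energy_covProd_le_integral_fieldIntegral_sq hL₁ hL₂ hF v)

end IsStrongWeakField

section Window

variable [IsProbabilityMeasure P] {Δ : Set (EuclideanSpace ℝ (Fin d))}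

theorem energy_majorant_isLittleO (hη : IsStrongWeakField P α β L₁ L₂ η)
    (hL₁ : SlowlyVarying L₁) (hL₂ : SlowlyVarying L₂) (hΔ : IsCompact Δ) (hvol : 0 < volume Δ)
    (hκ : 0 < κ) (hα : 0 < α) (hαd : α * κ < d) (hαβ : α * κ < β)
    (hinl : ∑ j, v (Sum.inl j) = 0) (hinr : ∑ j, v (Sum.inr j) = κ) :
    (fun r : ℝ => energy (majorant α β L₁ L₂ κ) (volume.restrict (r • Δ))) =o[atTop]
      fun r => energy (covProd α β L₁ L₂ v) (volume.restrict (r • Δ)) := by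
  have hcov : (covProd α β L₁ L₂ v : EuclideanSpace ℝ (Fin d) → ℝ) =
      fun x => corr α L₂ x ^ κ := by
    ext x
    rw [covProd_eq_corr_pow_mul_corr_pow, hinl, hinr, pow_zero, one_mul]
  obtain ⟨s, hs, hsd⟩ := exists_between hαd
  refine energy_isLittleO hΔ hvol (measurable_covProd hL₁ hL₂ v)
    (fun x => (covProd_pos hL₁ hL₂ v x).le) (hη.norm_covProd_le_one hL₁ hL₂ v)
    ((by positivity : 0 ≤ α * κ).trans hs.le) (by rwa [finrank_euclideanSpace_fin]) ?_
    (norm_majorant_le_one hL₁ hL₂) ?_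
  · rw [hcov]
    exact hL₂.eventually_rpow_neg_le_corr_pow hκ hs
  · rw [hcov]
    exact majorant_isLittleO hL₁ hL₂ hκ hα hαβ

theorem energy_covProd_isBigO_integral_fieldIntegral_sq (hη : IsStrongWeakField P α β L₁ L₂ η)
    (hL₁ : SlowlyVarying L₁) (hL₂ : SlowlyVarying L₂) (hΔ : IsCompact Δ)
    (hF : MemLp F 2 (stdGauss (Fin m ⊕ Fin n))) (hv : hermiteCoeff F v ≠ 0) :
    (fun r : ℝ => energy (covProd α β L₁ L₂ v) (volume.restrict (r • Δ))) =O[atTop]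
      fun r => ∫ ω, fieldIntegral η (volume.restrict (r • Δ)) F ω ^ 2 ∂P := by
  refine .of_bound (hermiteCoeff F v ^ 2 / (multiFactorial v : ℝ))⁻¹ (.of_forall fun r => ?_)
  have : IsFiniteMeasure (volume.restrict (r • Δ)) :=
    isFiniteMeasure_restrict.2 (hΔ.smul r).measure_lt_top.ne
  rw [Real.norm_of_nonneg (energy_nonneg fun x => (covProd_pos hL₁ hL₂ v x).le),
    Real.norm_of_nonneg (integral_nonneg fun _ => sq_nonneg _),
    le_inv_mul_iff₀ (div_pos (by positivity) (multiFactorial_pos v))]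
  exact hη.mul_energy_covProd_le_integral_fieldIntegral_sq hL₁ hL₂ hF v

theorem integral_fieldIntegral_sub_sq_isLittleO (hη : IsStrongWeakField P α β L₁ L₂ η)
    (hL₁ : SlowlyVarying L₁) (hL₂ : SlowlyVarying L₂) (hΔ : IsCompact Δ) (hvol : 0 < volume Δ)
    (hκ : 0 < κ) (hα : 0 < α) (hαd : α * κ < d) (hαβ : α * κ < β)
    (hinl : ∑ j, v (Sum.inl j) = 0) (hinr : ∑ j, v (Sum.inr j) = κ)
    (hF : MemLp F 2 (stdGauss (Fin m ⊕ Fin n))) (hH : MemLp H 2 (stdGauss (Fin m ⊕ Fin n)))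
    (hv : hermiteCoeff H v ≠ 0)
    (hFH : ∀ u, ¬IsNegligible κ u → hermiteCoeff F u = hermiteCoeff H u) :
    (fun r : ℝ => ∫ ω, (fieldIntegral η (volume.restrict (r • Δ)) F ω -
        fieldIntegral η (volume.restrict (r • Δ)) H ω) ^ 2 ∂P) =o[atTop]
      fun r => ∫ ω, fieldIntegral η (volume.restrict (r • Δ)) H ω ^ 2 ∂P := by
  have hfinite (r : ℝ) : IsFiniteMeasure (volume.restrict (r • Δ)) :=
    isFiniteMeasure_restrict.2 (hΔ.smul r).measure_lt_top.ne
  have hupper (r : ℝ) : ∫ ω, (fieldIntegral η (volume.restrict (r • Δ)) F ω -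
      fieldIntegral η (volume.restrict (r • Δ)) H ω) ^ 2 ∂P ≤
      (∫ w, (F - H) w ^ 2 ∂(stdGauss (Fin m ⊕ Fin n))) *
        energy (majorant α β L₁ L₂ κ) (volume.restrict (r • Δ)) := by
    refine le_of_eq_of_le (integral_congr_ae ?_)
      (hη.integral_fieldIntegral_sq_le_energy_majorant hL₁ hL₂ (hF.sub hH) fun u hu =>
        by_contra fun h => hu (by rw [hermiteCoeff_sub hF hH, hFH u h, sub_self]))
    filter_upwards [hη.hasMarginalLaw.fieldIntegral_sub (μ := volume.restrict (r • Δ)) hF hH]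
      with ω hω
    rw [hω, Pi.sub_apply]
  refine (IsBigO.of_norm_le fun r => ?_).trans_isLittleO
    (((energy_majorant_isLittleO hη hL₁ hL₂ hΔ hvol hκ hα hαd hαβ hinl hinr).const_mul_left
      (∫ w, (F - H) w ^ 2 ∂(stdGauss (Fin m ⊕ Fin n)))).trans_isBigO
        (energy_covProd_isBigO_integral_fieldIntegral_sq hη hL₁ hL₂ hΔ hH hv))
  rw [Real.norm_of_nonneg (integral_nonneg fun _ => sq_nonneg _)]
  exact hupper r

end Window

end CovarianceBounds

section MultiIndices

variable {m n : ℕ} {α β : ℝ} {κ : ℕ} {G : (Fin m ⊕ Fin n → ℝ) → ℝ} {v : Fin m ⊕ Fin n → ℕ}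

theorem hermiteCoeff_zero {ι : Type*} [Fintype ι] (G : (ι → ℝ) → ℝ) :
    hermiteCoeff G 0 = ∫ w, G w ∂(stdGauss ι) := by
  simp [hermiteCoeff, hermiteProd]

theorem IsHermiteRank.le_sum {ι : Type*} [Fintype ι] {G : (ι → ℝ) → ℝ} {v : ι → ℕ}
    (hκ : IsHermiteRank G κ) (hG₀ : ∫ w, G w ∂(stdGauss ι) = 0) (hv : hermiteCoeff G v ≠ 0) :
    κ ≤ ∑ j, v j := by
  refine hκ.2 ⟨Nat.one_le_iff_ne_zero.2 fun hsum => hv ?_, v, mem_multiIndices.2 rfl, hv⟩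
  have hzero : v = 0 := funext fun j => Finset.sum_eq_zero_iff.1 hsum j (Finset.mem_univ j)
  rw [hzero, hermiteCoeff_zero, hG₀]

theorem mem_Nplus_iff : v ∈ Nplus G κ ↔ hermiteCoeff G v ≠ 0 ∧
    κ ≤ ∑ j, v (Sum.inl j) + ∑ j, v (Sum.inr j) := by
  simp [Nplus, mem_multiIndices, Fintype.sum_sum_type]

theorem weight_eq (v : Fin m ⊕ Fin n → ℕ) : weight α β v =
    β * (∑ j, v (Sum.inl j) : ℕ) + α * (∑ j, v (Sum.inr j) : ℕ) := by
  simp [weight]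

theorem mul_le_weight (hα : 0 ≤ α) (hαβ : α ≤ β) (hv : v ∈ Nplus G κ) :
    α * κ ≤ weight α β v := by
  calc α * κ ≤ α * (∑ j, v (Sum.inl j) + ∑ j, v (Sum.inr j) : ℕ) := by
        gcongr
        exact (mem_Nplus_iff.1 hv).2
    _ = α * (∑ j, v (Sum.inl j) : ℕ) + α * (∑ j, v (Sum.inr j) : ℕ) := by push_cast; ring
    _ ≤ weight α β v := by rw [weight_eq]; gcongr

theorem sum_inl_eq_zero (hv : v ∈ multiIndices (Fin m ⊕ Fin n) κ)
    (hinr : ∑ j, v (Sum.inr j) = κ) : ∑ j, v (Sum.inl j) = 0 := by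
  rwa [mem_multiIndices, Fintype.sum_sum_type, hinr, Nat.add_eq_right] at hv

theorem weight_eq_mul (hv : v ∈ multiIndices (Fin m ⊕ Fin n) κ)
    (hinr : ∑ j, v (Sum.inr j) = κ) : weight α β v = α * κ := by
  rw [weight_eq, sum_inl_eq_zero hv hinr, hinr, Nat.cast_zero, mul_zero, zero_add]

theorem mem_Nstar_of_sum_inr_eq (hα : 0 ≤ α) (hαβ : α ≤ β)
    (hv : v ∈ multiIndices (Fin m ⊕ Fin n) κ) (hvG : v ∈ Nplus G κ)
    (hinr : ∑ j, v (Sum.inr j) = κ) : v ∈ Nstar G κ α β κ := by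
  have hmin : minWeight G κ α β = weight α β v := by
    refine IsLeast.csInf_eq ⟨⟨v, hvG, rfl⟩, ?_⟩
    rintro _ ⟨u, hu, rfl⟩
    exact (weight_eq_mul hv hinr).trans_le (mul_le_weight hα hαβ hu)
  classical
  exact Finset.mem_filter.2 ⟨hv, hvG, hmin.symm⟩

theorem mem_Nstar_of_not_isNegligible (hα : 0 ≤ α) (hαβ : α ≤ β) (hκ : IsHermiteRank G κ)
    (hG₀ : ∫ w, G w ∂(stdGauss (Fin m ⊕ Fin n)) = 0) (hv : hermiteCoeff G v ≠ 0)
    (hneg : ¬IsNegligible κ v) : v ∈ Nstar G κ α β κ := by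
  obtain ⟨hinl, hinr_le⟩ : ∑ j, v (Sum.inl j) = 0 ∧ ∑ j, v (Sum.inr j) ≤ κ := by
    simpa only [IsNegligible, not_or, not_not, not_lt] using hneg
  have hle := hκ.le_sum hG₀ hv
  rw [Fintype.sum_sum_type, hinl, zero_add] at hle
  have hinr := hinr_le.antisymm hle
  refine mem_Nstar_of_sum_inr_eq hα hαβ ?_ (mem_Nplus_iff.2 ⟨hv, ?_⟩) hinr
  · rw [mem_multiIndices, Fintype.sum_sum_type, hinl, hinr, zero_add]
  · rw [hinl, hinr, zero_add]

theorem Nstar_subset_multiIndices (G : (Fin m ⊕ Fin n → ℝ) → ℝ) (κ : ℕ) (α β : ℝ) (l : ℕ) :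
    Nstar G κ α β l ⊆ multiIndices (Fin m ⊕ Fin n) l := by
  classical
  exact Finset.filter_subset _ _

theorem hermiteCoeff_hermitePartial_of_not_isNegligible (hα : 0 ≤ α) (hαβ : α ≤ β)
    (hκ : IsHermiteRank G κ) (hG₀ : ∫ w, G w ∂(stdGauss (Fin m ⊕ Fin n)) = 0)
    {S : Finset (Fin m ⊕ Fin n → ℕ)} (hS : Nstar G κ α β κ ⊆ S) (hneg : ¬IsNegligible κ v) :
    hermiteCoeff (hermitePartial G S) v = hermiteCoeff G v := by
  classical
  rw [hermiteCoeff_hermitePartial, ite_eq_left_iff]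
  exact fun hvS => .symm <| by_contra fun hv =>
    hvS (hS (mem_Nstar_of_not_isNegligible hα hαβ hκ hG₀ hv hneg))

end MultiIndices

section Comparison

variable {d m n : ℕ} {Ω : Type*} [MeasurableSpace Ω] {P : Measure Ω} [IsProbabilityMeasure P]
  {α β : ℝ} {L₁ L₂ : ℝ → ℝ} {η : EuclideanSpace ℝ (Fin d) → Ω → (Fin m ⊕ Fin n → ℝ)}
  {Δ : Set (EuclideanSpace ℝ (Fin d))} {κ : ℕ} {v : Fin m ⊕ Fin n → ℕ}
  {F G H : (Fin m ⊕ Fin n → ℝ) → ℝ} {S : Finset (Fin m ⊕ Fin n → ℕ)} {r : ℝ}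

theorem le_of_mul_natCast_lt (hα : 0 ≤ α) (hκ : 1 ≤ κ) (hαβ : α * κ < β) : α ≤ β :=
  (le_mul_of_one_le_right hα (Nat.one_le_cast.2 hκ)).trans hαβ.le

theorem IsWindow.volume_pos (hΔ : IsWindow Δ) : 0 < volume Δ :=
  (isOpen_interior.measure_pos volume ⟨0, hΔ.zero_mem⟩).trans_le (measure_mono interior_subset)

theorem neZero_restrict_smul (hvol : 0 < volume Δ) (hr : 0 < r) :
    NeZero (volume.restrict (r • Δ)) := by
  refine ⟨Measure.restrict_eq_zero.not.2 ?_⟩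
  rw [Measure.addHaar_smul]
  exact mul_ne_zero (ENNReal.ofReal_pos.2 (by positivity)).ne' hvol.ne'

namespace IsStrongWeakField

theorem hermiteSum_ae_eq_fieldIntegral (hη : IsStrongWeakField P α β L₁ L₂ η) (hΔ : IsCompact Δ)
    (G : (Fin m ⊕ Fin n → ℝ) → ℝ) (S : Finset (Fin m ⊕ Fin n → ℕ)) (r : ℝ) :
    hermiteSum Δ G η S r =ᵐ[P] fieldIntegral η (volume.restrict (r • Δ)) (hermitePartial G S) := by
  have : IsFiniteMeasure (volume.restrict (r • Δ)) :=
    isFiniteMeasure_restrict.2 (hΔ.smul r).measure_lt_top.ne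
  exact (hη.hasMarginalLaw.fieldIntegral_hermitePartial G S).symm

theorem variance_fieldIntegral_pos (hη : IsStrongWeakField P α β L₁ L₂ η)
    (hL₁ : SlowlyVarying L₁) (hL₂ : SlowlyVarying L₂) {μ : Measure (EuclideanSpace ℝ (Fin d))}
    [IsFiniteMeasure μ] [NeZero μ] (hF : MemLp F 2 (stdGauss (Fin m ⊕ Fin n)))
    (hF₀ : ∫ w, F w ∂(stdGauss (Fin m ⊕ Fin n)) = 0) (hv : hermiteCoeff F v ≠ 0) :
    0 < variance (fieldIntegral η μ F) P := by
  have hmem := hη.hasMarginalLaw.memLp_fieldIntegral (μ := μ) hF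
  rw [variance_of_integral_eq_zero hmem.aestronglyMeasurable.aemeasurable
    (by rw [hη.hasMarginalLaw.integral_fieldIntegral hF, hF₀, mul_zero])]
  exact hη.integral_fieldIntegral_sq_pos hL₁ hL₂ hF hv

theorem isEquivalent_variance_and_hasLimitLaw_iff (hη : IsStrongWeakField P α β L₁ L₂ η)
    (hL₁ : SlowlyVarying L₁) (hL₂ : SlowlyVarying L₂) (hΔ : IsCompact Δ) (hvol : 0 < volume Δ)
    (hκ : 0 < κ) (hα : 0 < α) (hαd : α * κ < d) (hαβ : α * κ < β)
    (hinl : ∑ j, v (Sum.inl j) = 0) (hinr : ∑ j, v (Sum.inr j) = κ)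
    (hF : MemLp F 2 (stdGauss (Fin m ⊕ Fin n))) (hH : MemLp H 2 (stdGauss (Fin m ⊕ Fin n)))
    (hH₀ : ∫ w, H w ∂(stdGauss (Fin m ⊕ Fin n)) = 0) (hv : hermiteCoeff H v ≠ 0)
    (hFH : ∀ u, ¬IsNegligible κ u → hermiteCoeff F u = hermiteCoeff H u) :
    (fun r : ℝ => variance (fieldIntegral η (volume.restrict (r • Δ)) F) P) ~[atTop]
        (fun r => variance (fieldIntegral η (volume.restrict (r • Δ)) H) P) ∧
      ∀ (ν : Measure ℝ) [IsProbabilityMeasure ν],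
        HasLimitLaw P (fun r => fieldIntegral η (volume.restrict (r • Δ)) F) ν ↔
          HasLimitLaw P (fun r => fieldIntegral η (volume.restrict (r • Δ)) H) ν := by
  have hfinite (r : ℝ) : IsFiniteMeasure (volume.restrict (r • Δ)) :=
    isFiniteMeasure_restrict.2 (hΔ.smul r).measure_lt_top.ne
  have hmem {F : (Fin m ⊕ Fin n → ℝ) → ℝ} (hF : MemLp F 2 (stdGauss (Fin m ⊕ Fin n))) (r : ℝ) :
      MemLp (fieldIntegral η (volume.restrict (r • Δ)) F) 2 P :=
    hη.hasMarginalLaw.memLp_fieldIntegral hF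
  have hmean {F : (Fin m ⊕ Fin n → ℝ) → ℝ} (hF : MemLp F 2 (stdGauss (Fin m ⊕ Fin n)))
      (hF₀ : ∫ w, F w ∂(stdGauss (Fin m ⊕ Fin n)) = 0) (r : ℝ) :
      ∫ ω, fieldIntegral η (volume.restrict (r • Δ)) F ω ∂P = 0 := by
    rw [hη.hasMarginalLaw.integral_fieldIntegral hF, hF₀, mul_zero]
  have hF₀ : ∫ w, F w ∂(stdGauss (Fin m ⊕ Fin n)) = 0 := by
    rw [← hermiteCoeff_zero, hFH 0 (by simp [IsNegligible]), hermiteCoeff_zero, hH₀]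
  have hdiff := integral_fieldIntegral_sub_sq_isLittleO hη hL₁ hL₂ hΔ hvol hκ hα hαd hαβ
    hinl hinr hF hH hv hFH
  exact ⟨isEquivalent_variance (hmem hF) (hmem hH) (hmean hF hF₀) (hmean hH hH₀) hdiff,
    fun _ _ => hasLimitLaw_iff (hmem hF) (hmem hH) (hmean hF hF₀) (hmean hH hH₀) hdiff⟩

theorem memLp_hermiteSum (hη : IsStrongWeakField P α β L₁ L₂ η) (hΔ : IsCompact Δ)
    (G : (Fin m ⊕ Fin n → ℝ) → ℝ) (S : Finset (Fin m ⊕ Fin n → ℕ)) (r : ℝ) :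
    MemLp (hermiteSum Δ G η S r) 2 P := by
  have : IsFiniteMeasure (volume.restrict (r • Δ)) :=
    isFiniteMeasure_restrict.2 (hΔ.smul r).measure_lt_top.ne
  exact (hη.hasMarginalLaw.memLp_fieldIntegral (memLp_hermitePartial G S)).ae_eq
    (hη.hermiteSum_ae_eq_fieldIntegral hΔ G S r).symm

theorem variance_K_pos (hη : IsStrongWeakField P α β L₁ L₂ η) (hL₁ : SlowlyVarying L₁)
    (hL₂ : SlowlyVarying L₂) (hΔ : IsCompact Δ) (hvol : 0 < volume Δ)
    (hG : MemLp G 2 (stdGauss (Fin m ⊕ Fin n)))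
    (hG₀ : ∫ w, G w ∂(stdGauss (Fin m ⊕ Fin n)) = 0) (hv : hermiteCoeff G v ≠ 0) (hr : 0 < r) :
    0 < variance (K Δ G η r) P := by
  have : IsFiniteMeasure (volume.restrict (r • Δ)) :=
    isFiniteMeasure_restrict.2 (hΔ.smul r).measure_lt_top.ne
  have := neZero_restrict_smul hvol hr
  exact hη.variance_fieldIntegral_pos hL₁ hL₂ hG hG₀ hv

theorem variance_hermiteSum_pos (hη : IsStrongWeakField P α β L₁ L₂ η) (hL₁ : SlowlyVarying L₁)
    (hL₂ : SlowlyVarying L₂) (hΔ : IsCompact Δ) (hvol : 0 < volume Δ)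
    (hG₀ : ∫ w, G w ∂(stdGauss (Fin m ⊕ Fin n)) = 0) (hv : hermiteCoeff G v ≠ 0) (hvS : v ∈ S)
    (hr : 0 < r) : 0 < variance (hermiteSum Δ G η S r) P := by
  classical
  rw [variance_congr (hη.hermiteSum_ae_eq_fieldIntegral hΔ G S r)]
  refine hη.variance_K_pos hL₁ hL₂ hΔ hvol (memLp_hermitePartial G S) (v := v) ?_ ?_ hr
  · rw [← hermiteCoeff_zero, hermiteCoeff_hermitePartial, hermiteCoeff_zero, hG₀, ite_self]
  · rwa [hermiteCoeff_hermitePartial, if_pos hvS]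

theorem isEquivalent_variance_K_and_hasLimitLaw_iff (hη : IsStrongWeakField P α β L₁ L₂ η)
    (hL₁ : SlowlyVarying L₁) (hL₂ : SlowlyVarying L₂) (hΔ : IsCompact Δ) (hvol : 0 < volume Δ)
    (hα : 0 < α) (hαd : α * κ < d) (hαβ : α * κ < β)
    (hG : MemLp G 2 (stdGauss (Fin m ⊕ Fin n)))
    (hG₀ : ∫ w, G w ∂(stdGauss (Fin m ⊕ Fin n)) = 0) (hκ : IsHermiteRank G κ)
    (hv : v ∈ multiIndices (Fin m ⊕ Fin n) κ) (hvG : hermiteCoeff G v ≠ 0)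
    (hinr : ∑ j, v (Sum.inr j) = κ) (hS : Nstar G κ α β κ ⊆ S) :
    (fun r : ℝ => variance (K Δ G η r) P) ~[atTop]
        (fun r => variance (hermiteSum Δ G η S r) P) ∧
      ∀ (ν : Measure ℝ) [IsProbabilityMeasure ν],
        HasLimitLaw P (K Δ G η) ν ↔ HasLimitLaw P (hermiteSum Δ G η S) ν := by
  have hα_le : α ≤ β := le_of_mul_natCast_lt hα.le hκ.1.1 hαβ
  have hcoeff {u : Fin m ⊕ Fin n → ℕ} (hu : ¬IsNegligible κ u) :
      hermiteCoeff (hermitePartial G S) u = hermiteCoeff G u :=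
    hermiteCoeff_hermitePartial_of_not_isNegligible hα.le hα_le hκ hG₀ hS hu
  have hcongr := hη.hermiteSum_ae_eq_fieldIntegral hΔ G S
  have hcomp := hη.isEquivalent_variance_and_hasLimitLaw_iff hL₁ hL₂ hΔ hvol hκ.1.1 hα hαd hαβ
    (sum_inl_eq_zero hv hinr) hinr (memLp_hermitePartial G S) hG hG₀ hvG fun u => hcoeff
  simp only [fun r => variance_congr (hcongr r)]
  exact ⟨hcomp.1.symm, fun ν _ => (hcomp.2 ν).symm.trans (hasLimitLaw_congr hcongr).symm⟩

end IsStrongWeakField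

end Comparison

end StrongWeak

theorem theorem1_general {d m n : ℕ} {Ω : Type*} [MeasurableSpace Ω] (P : Measure Ω)
    [IsProbabilityMeasure P]
    (Δ : Set (EuclideanSpace ℝ (Fin d))) (hΔ : IsCompact Δ) (hvol : 0 < volume Δ)
    (κ : ℕ) (α β : ℝ) (hα : 0 < α) (hαd : α * κ < d) (hαβ : α * κ < β)
    (L₁ L₂ : ℝ → ℝ) (hL₁ : SlowlyVarying L₁) (hL₂ : SlowlyVarying L₂)
    (η : EuclideanSpace ℝ (Fin d) → Ω → (Fin m ⊕ Fin n → ℝ))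
    (hη : IsStrongWeakField P α β L₁ L₂ η)
    (G : (Fin m ⊕ Fin n → ℝ) → ℝ) (hG : MemLp G 2 (stdGauss (Fin m ⊕ Fin n)))
    (hG₀ : ∫ w, G w ∂(stdGauss (Fin m ⊕ Fin n)) = 0)
    (hκ : IsHermiteRank G κ)
    (hv : ∃ v ∈ multiIndices (Fin m ⊕ Fin n) κ, v ∈ Nplus G κ ∧ ∑ j : Fin n, v (Sum.inr j) = κ) :
    (∀ r : ℝ, 0 < r →
      (∀ᵐ ω ∂P, IntegrableOn (fun x => G (η x ω)) (r • Δ)) ∧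
      (∀ v : Fin m ⊕ Fin n → ℕ, ∀ᵐ ω ∂P, IntegrableOn (fun x => hermiteProd v (η x ω)) (r • Δ)) ∧
      (MemLp (K Δ G η r) 2 P ∧ 0 < variance (K Δ G η r) P) ∧
      (MemLp (Krank Δ G η κ r) 2 P ∧ 0 < variance (Krank Δ G η κ r) P) ∧
      (MemLp (Kstar Δ G η κ α β κ r) 2 P ∧ 0 < variance (Kstar Δ G η κ α β κ r) P)) ∧
    (∀ (ν : Measure ℝ) [IsProbabilityMeasure ν],
      HasLimitLaw P (K Δ G η) ν ↔ HasLimitLaw P (Krank Δ G η κ) ν) ∧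
    (∀ (ν : Measure ℝ) [IsProbabilityMeasure ν],
      HasLimitLaw P (Krank Δ G η κ) ν ↔ HasLimitLaw P (Kstar Δ G η κ α β κ) ν) ∧
    Asymptotics.IsEquivalent atTop
      (fun r : ℝ => variance (K Δ G η r) P) (fun r : ℝ => variance (Krank Δ G η κ r) P) ∧
    Asymptotics.IsEquivalent atTop
      (fun r : ℝ => variance (Krank Δ G η κ r) P)
      (fun r : ℝ => variance (Kstar Δ G η κ α β κ r) P) := by
  obtain ⟨v, hvκ, hvG, hinr⟩ := hv
  have hα_le : α ≤ β := le_of_mul_natCast_lt hα.le hκ.1.1 hαβ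
  have hstar : v ∈ Nstar G κ α β κ := mem_Nstar_of_sum_inr_eq hα.le hα_le hvκ hvG hinr
  have hsub := Nstar_subset_multiIndices G κ α β κ
  have hcomp {S : Finset (Fin m ⊕ Fin n → ℕ)} (hS : Nstar G κ α β κ ⊆ S) :=
    hη.isEquivalent_variance_K_and_hasLimitLaw_iff hL₁ hL₂ hΔ hvol hα hαd hαβ hG hG₀ hκ hvκ
      hvG.1 hinr hS
  have hpos {S : Finset (Fin m ⊕ Fin n → ℕ)} (hvS : v ∈ S) {r : ℝ} (hr : 0 < r) :=
    hη.variance_hermiteSum_pos hL₁ hL₂ hΔ hvol hG₀ hvG.1 hvS hr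
  obtain ⟨hvar, hlaw⟩ := hcomp hsub
  obtain ⟨hvar_star, hlaw_star⟩ := hcomp subset_rfl
  refine ⟨fun r hr => ?_, fun ν _ => hlaw ν, fun ν _ => (hlaw ν).symm.trans (hlaw_star ν), hvar,
    hvar.symm.trans hvar_star⟩
  have : IsFiniteMeasure (volume.restrict (r • Δ)) :=
    isFiniteMeasure_restrict.2 (hΔ.smul r).measure_lt_top.ne
  exact ⟨hη.hasMarginalLaw.ae_integrable hG,
    fun v => hη.hasMarginalLaw.ae_integrable (memLp_hermiteProd v),
    ⟨hη.hasMarginalLaw.memLp_fieldIntegral hG, hη.variance_K_pos hL₁ hL₂ hΔ hvol hG hG₀ hvG.1 hr⟩,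
    ⟨hη.memLp_hermiteSum hΔ G _ r, hpos (hsub hstar) hr⟩,
    ⟨hη.memLp_hermiteSum hΔ G _ r, hpos hstar hr⟩⟩

theorem theorem1 {d m n : ℕ} {Ω : Type*} [MeasurableSpace Ω] (P : Measure Ω) [IsProbabilityMeasure P]
    (Δ : Set (EuclideanSpace ℝ (Fin d))) (hΔ : IsWindow Δ)
    (κ : ℕ) (α β : ℝ) (hα : 0 < α) (hακ : α < d / κ) (hβ : (d : ℝ) < β)
    (L₁ L₂ : ℝ → ℝ) (hL₁ : SlowlyVarying L₁) (hL₂ : SlowlyVarying L₂)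
    (η : EuclideanSpace ℝ (Fin d) → Ω → (Fin m ⊕ Fin n → ℝ))
    (hη : IsStrongWeakField P α β L₁ L₂ η)
    (G : (Fin m ⊕ Fin n → ℝ) → ℝ) (hG : MemLp G 2 (stdGauss (Fin m ⊕ Fin n)))
    (hG₀ : ∫ w, G w ∂(stdGauss (Fin m ⊕ Fin n)) = 0)
    (hκ : IsHermiteRank G κ)
    (hv : ∃ v ∈ multiIndices (Fin m ⊕ Fin n) κ, v ∈ Nplus G κ ∧ ∑ j : Fin n, v (Sum.inr j) = κ) :
    -- for every `r > 0` the integrals and the normalizations are well defined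
    (∀ r : ℝ, 0 < r →
      (∀ᵐ ω ∂P, IntegrableOn (fun x => G (η x ω)) (r • Δ)) ∧
      (∀ v : Fin m ⊕ Fin n → ℕ, ∀ᵐ ω ∂P, IntegrableOn (fun x => hermiteProd v (η x ω)) (r • Δ)) ∧
      (MemLp (K Δ G η r) 2 P ∧ 0 < variance (K Δ G η r) P) ∧
      (MemLp (Krank Δ G η κ r) 2 P ∧ 0 < variance (Krank Δ G η κ r) P) ∧
      (MemLp (Kstar Δ G η κ α β κ r) 2 P ∧ 0 < variance (Kstar Δ G η κ α β κ r) P)) ∧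
    -- the limit laws
    (∀ (ν : Measure ℝ) [IsProbabilityMeasure ν],
      HasLimitLaw P (K Δ G η) ν ↔ HasLimitLaw P (Krank Δ G η κ) ν) ∧
    (∀ (ν : Measure ℝ) [IsProbabilityMeasure ν],
      HasLimitLaw P (Krank Δ G η κ) ν ↔ HasLimitLaw P (Kstar Δ G η κ α β κ) ν) ∧
    -- the variances
    Asymptotics.IsEquivalent atTop
      (fun r : ℝ => variance (K Δ G η r) P) (fun r : ℝ => variance (Krank Δ G η κ r) P) ∧
    Asymptotics.IsEquivalent atTop
      (fun r : ℝ => variance (Krank Δ G η κ r) P)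
      (fun r : ℝ => variance (Kstar Δ G η κ α β κ r) P) := by
  have hακd : α * κ < d := (lt_div_iff₀ (Nat.cast_pos.2 hκ.1.1)).1 hακ
  exact theorem1_general P Δ hΔ.isCompact hΔ.volume_pos κ α β hα hακd (hακd.trans hβ) L₁ L₂ hL₁ hL₂
    η hη G hG hG₀ hκ hv
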